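/- Let $n\ge 1$. A \emph{2-Dyck path} of length $3n$ is a sequence of $3n$ steps, each an up-step $\nearrow$ ($+1$) or a down-step $\searrow$ ($-2$), all of whose partial sums are nonnegative and whose total sum is $0$. A \emph{non-crossing spanning tree} (NCST) with $n$ edges is a tree on the vertex set $\{0,1,\dots,n\}$ whose edges, written as pairs $(a,b)$ with $a<b$, contain no two edges $(a,b),(c,d)$ with $a<c<b<d$. \emph{Correspondence.} Paths and trees correspond recursively: the empty path corresponds to the one-vertex tree. If $T$ is a tree on consecutive points $a,\dots,b$ with at least one edge, let $t$ be maximal such that $(a,t)$ is an edge of $T$, and let $s$ be such that after removing $(a,t)$ the points $a,\dots,s$ are connected by $T$ but $a,\dots,s+1$ are not; if the parts of $T$ on $[a,s]$, $[s+1,t]$, $[t,b]$ correspond to the paths $A,B,C$, then $T$ corresponds to the path $\nearrow A\nearrow B\searrow C$. This is a bijection $X\mapsto T_X$ from the 2-Dyck paths of length $3n$ onto the NCSTs with $n$ edges. \emph{Chains.} The adjacent move chain $P_{\mathrm{AM}}$ on 2-Dyck paths of length $3n$ has, for $X\ne X'$, $P_{\mathrm{AM}}(X,X')=\frac1{6n-2}$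 if $X'$ is obtained from $X$ by swapping two adjacent steps, and $0$ otherwise; with the remaining probability it stays put. The flip chain $P_{\mathrm{FM}}$ on NCSTs with $n$ edges removes a uniformly random edge of the current tree and then adds back an edge chosen uniformly among all edges that yield an NCST; thus for $S\neq T$, $P_{\mathrm{FM}}(S,T)=\frac1{n\,\delta(S,T)}$ if $|S\cap T|=n-1$, where $\delta(S,T)$ is the number of edges that can be added to $S\cap T$ to make it an NCST, and $0$ otherwise. For a chain $P$ on a finite set $\Omega$ with the uniform stationary distribution $\pi$, the Dirichlet form is $\mathcal E_P(f,g)=\frac12\sum_{x,y\in\Omega}(f(x)-f(y))(g(x)-g(y))\,\pi(x)P(x,y)$; write $\mathcal E_{\mathrm{AM}}$ and $\mathcal E_{\mathrm{FM}}$ for those of $P_{\mathrm{AM}}$ and $P_{\mathrm{FM}}$. \textbf{Lemma.} There is an absolute constant $c>0$ such that for every $n\ge1$ the correspondence above is a bijection and, for every real-valued function $f$ on the 2-Dyck paths of length $3n$, regarded also as a function on NCSTs through $f(T_X)=f(X)$, \[ \mathcal E_{\mathrm{FM}}(f,f)\;\ge\; \frac{c}{n^{4}}\;\mathcal E_{\mathrm{AM}}(f,f).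 \] -/

import Mathlib

noncomputable section

open scoped Classical

namespace FlipChain

/-! ### Dirichlet forms of finite chains -/

/-- The Dirichlet form of a transition matrix `P` with stationary distribution `π`. -/
def dirichletForm {Ω : Type*} [Fintype Ω] (π : Ω → ℝ) (P : Ω → Ω → ℝ) (f g : Ω → ℝ) : ℝ :=
  (1 / 2) * ∑ x, ∑ y, (f x - f y) * (g x - g y) * π x * P x y

/-- The uniform distribution on a finite type. -/
def uniformDist (Ω : Type*) [Fintype Ω] : Ω → ℝ := fun _ => 1 / (Fintype.card Ω : ℝ)

/-! ### 2-Dyck paths and the adjacent move chain -/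

/-- An up-step raises the height by `1`, a down-step lowers it by `2`. -/
def stepVal : DyckStep → ℤ
  | DyckStep.U => 1
  | DyckStep.D => -2

/-- The height reached after all the steps of `w`. -/
def height (w : List DyckStep) : ℤ := (w.map stepVal).sum

/-- `w` never goes below height `0` and ends at height `0`. -/
def IsTwoDyck (w : List DyckStep) : Prop :=
  (∀ j ≤ w.length, 0 ≤ height (w.take j)) ∧ height w = 0

/-- The 2-Dyck paths of length `3 n`. -/
abbrev TwoDyck (n : ℕ) : Type := {w : List DyckStep // w.length = 3 * n ∧ IsTwoDyck w}

instance : Finite DyckStep :=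
  Finite.of_injective (fun s : DyckStep => decide (s = DyckStep.U)) (by
    intro a b h; cases a <;> cases b <;> simp_all)

instance (n : ℕ) : Finite (TwoDyck n) :=
  Set.Finite.subset (List.finite_length_eq DyckStep (3 * n)) (fun _ h => h.1)

instance (n : ℕ) : Fintype (TwoDyck n) := Fintype.ofFinite _

/-- `w'` results from `w` by swapping the steps at two adjacent positions. -/
def AdjSwap (w w' : List DyckStep) : Prop :=
  ∃ (u v : List DyckStep) (a b : DyckStep), w = u ++ a :: b :: v ∧ w' = u ++ b :: a :: v

/-- The 2-Dyck paths other than `X` that result from `X` by one adjacent swap. -/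
def adjNeighbors {n : ℕ} (X : TwoDyck n) : Finset (TwoDyck n) :=
  Finset.univ.filter fun X' => X' ≠ X ∧ AdjSwap X.1 X'.1

/-- Transition matrix of the adjacent move chain: one of the `3 n - 1` positions is chosen
uniformly, and a valid swap there is carried out with probability `1 / 2`. -/
def PAM (n : ℕ) (X X' : TwoDyck n) : ℝ :=
  if X = X' then 1 - ((adjNeighbors X).card : ℝ) / (6 * (n : ℝ) - 2)
  else if X' ∈ adjNeighbors X then 1 / (6 * (n : ℝ) - 2)
  else 0

/-- Dirichlet form of the adjacent move chain over the uniform distribution. -/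
def dirichletAM (n : ℕ) (f g : TwoDyck n → ℝ) : ℝ :=
  dirichletForm (uniformDist (TwoDyck n)) (PAM n) f g

/-! ### Non-crossing spanning trees and the flip chain -/

/-- The graph on the points `0, …, n` whose edges are the pairs in `E`. -/
def edgeGraph (n : ℕ) (E : Finset (ℕ × ℕ)) : SimpleGraph (Fin (n + 1)) :=
  SimpleGraph.fromRel fun i j => ((i : ℕ), (j : ℕ)) ∈ E

/-- `E` is the edge set of a non-crossing spanning tree on `0, …, n`: edges are pairs `(a, b)` with
`0 ≤ a < b ≤ n`, no two edges satisfy `a < c < b < d`, and the graph is a tree. -/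
def IsNCST (n : ℕ) (E : Finset (ℕ × ℕ)) : Prop :=
  (∀ e ∈ E, e.1 < e.2 ∧ e.2 ≤ n) ∧
  (∀ e ∈ E, ∀ e' ∈ E, ¬ (e.1 < e'.1 ∧ e'.1 < e.2 ∧ e.2 < e'.2)) ∧
  (edgeGraph n E).IsTree

/-- The non-crossing spanning trees with `n` edges, i.e. on the points `0, …, n`. -/
abbrev NCST (n : ℕ) : Type := {E : Finset (ℕ × ℕ) // IsNCST n E}

instance (n : ℕ) : Finite (NCST n) :=
  Set.Finite.subset
    (Finset.finite_toSet (Finset.range (n + 1) ×ˢ Finset.range (n + 1)).powerset) (by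
      intro E hE
      simp only [Finset.coe_powerset, Set.mem_preimage, Set.mem_powerset_iff]
      intro e he
      have h := hE.1 e he
      simp only [Finset.coe_product, Finset.coe_range, Set.mem_prod, Set.mem_Iio]
      omega)

instance (n : ℕ) : Fintype (NCST n) := Fintype.ofFinite _

/-- The number of edges that can be added to `F` so as to make it a non-crossing spanning tree. -/
def numCompletions (n : ℕ) (F : Finset (ℕ × ℕ)) : ℕ :=
  ((Finset.range (n + 1) ×ˢ Finset.range (n + 1)).filter
    fun e => e ∉ F ∧ IsNCST n (insert e F)).card

/-- Transition matrix of the flip chain: an edge of `S` chosen uniformly is removed, and an edge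
chosen uniformly among those that give a non-crossing spanning tree is added back. -/
def PFM (n : ℕ) (S T : NCST n) : ℝ :=
  if S = T then ∑ e ∈ S.1, 1 / ((n : ℝ) * (numCompletions n (S.1.erase e) : ℝ))
  else if (S.1 ∩ T.1).card + 1 = n then 1 / ((n : ℝ) * (numCompletions n (S.1 ∩ T.1) : ℝ))
  else 0

/-- Dirichlet form of the flip chain over the uniform distribution. -/
def dirichletFM (n : ℕ) (f g : NCST n → ℝ) : ℝ :=
  dirichletForm (uniformDist (NCST n)) (PFM n) f g

/-! ### The correspondence between paths and trees -/

/-- `Corresponds w a b E`: the path `w` corresponds to the non-crossing tree with edge set `E` on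
the consecutive points `a, a + 1, …, b`. The empty path corresponds to the empty tree on one point.
A tree on `a, …, b` with pivot edge `(a, t)` and the gap beneath it between `s` and `s + 1`,
whose parts on `[a, s]`, `[s + 1, t]`, `[t, b]` correspond to the paths `A`, `B`, `C`, corresponds
to the path `U A U B D C`. -/
inductive Corresponds : List DyckStep → ℕ → ℕ → Finset (ℕ × ℕ) → Prop
  | empty (a : ℕ) : Corresponds [] a a ∅
  | node {A B C : List DyckStep} {a s t b : ℕ} {TA TB TC : Finset (ℕ × ℕ)}
      (hA : Corresponds A a s TA) (hB : Corresponds B (s + 1) t TB) (hC : Corresponds C t b TC) :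
      Corresponds (DyckStep.U :: A ++ DyckStep.U :: B ++ DyckStep.D :: C) a b
        (insert (a, t) (TA ∪ TB ∪ TC))

end FlipChain

end

/-! Ternary trees `Tern` carry both sides of the correspondence: `node A B C` is read as the path U
A U B D C and as the tree whose pivot edge has A and B beneath it and C to its right. Each reading
is injective and reaches every path, respectively every non-crossing tree (`word_injective`,
`isTwoDyck_iff_exists_word`, `tree_injective`, `exists_tern_of_isTreeOn`); this gives `treeEquiv`.

The Dirichlet forms are compared by simulating each adjacent move with flips. A peak UUD inserted
anywhere in a path passes the next letter by a single flip (`flipWord_slide`). A valid swap of UD to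
DU happens in a block U A U D lying in the first or second slot of a parent block
(`exists_route_of_swap`). One flip turns the block into A UUD; the peak then slides past A or past a
neighbouring part L, and further flips rebuild the target. Every move thus costs three flips and one
slide of O(n) flips.

The losses are as follows. A flip over a forest with δ completions has probability only 1/(nδ), but
averaging over all completions makes it cost O(n) times the local energies at its two ends, without
δ (`sq_sub_le_of_flip`). Cauchy-Schwarz along a slide costs O(n). The trees at the ends of the three
separate flips are shared by O(n³) moves. The path W through which the peak slides is shared by only
O(n²) moves (`RouteWords.slide_unique`), and a given path arises by inserting a peak into some W in
O(n) ways (`sum_slideEnergy_le`). Slides therefore dominate with n · n² · n = n⁴, and the factor n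
of a single flip cancels against the probability of order 1/n of an adjacent move. -/

noncomputable section

open scoped Classical

namespace FlipChain

open DyckStep

/-! ### Ternary trees and their words -/

/-- Ternary trees; `node A B C` encodes both the word `U A U B D C` and the non-crossing tree whose
pivot edge has the parts `A`, `B` beneath it and `C` to its right. -/
inductive Tern : Type
  | nil : Tern
  | node (A B C : Tern) : Tern

namespace Tern

/-- Concatenation of the sequences of right spines. -/
def append : Tern → Tern → Tern
  | nil, S => S
  | node A B C, S => node A B (append C S)

instance : Append Tern := ⟨append⟩

@[simp] lemma nil_append (S : Tern) : nil ++ S = S := rfl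

@[simp] lemma node_append (A B C S : Tern) : node A B C ++ S = node A B (C ++ S) := rfl

@[simp] lemma append_nil (S : Tern) : S ++ nil = S := by
  induction S with
  | nil => rfl
  | node A B C _ _ ih => simp [ih]

lemma append_assoc (S T V : Tern) : S ++ T ++ V = S ++ (T ++ V) := by
  induction S with
  | nil => rfl
  | node A B C _ _ ih => simp [ih]

/-- The number of nodes. -/
def size : Tern → ℕ
  | nil => 0
  | node A B C => A.size + B.size + C.size + 1

@[simp] lemma size_nil : nil.size = 0 := rfl

@[simp] lemma size_node (A B C : Tern) : (node A B C).size = A.size + B.size + C.size + 1 := rfl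

@[simp] lemma size_append (S T : Tern) : (S ++ T).size = S.size + T.size := by
  induction S with
  | nil => simp
  | node A B C _ _ ih => simp [ih]; omega

/-- The 2-Dyck path of a ternary tree. -/
def word : Tern → List DyckStep
  | nil => []
  | node A B C => U :: A.word ++ U :: B.word ++ D :: C.word

@[simp] lemma word_nil : nil.word = [] := rfl

@[simp] lemma word_node (A B C : Tern) :
    (node A B C).word = U :: A.word ++ U :: B.word ++ D :: C.word := rfl

@[simp] lemma word_append (S T : Tern) : (S ++ T).word = S.word ++ T.word := by
  induction S with
  | nil => simp
  | node A B C _ _ ih => simp [ih]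

@[simp] lemma length_word (T : Tern) : T.word.length = 3 * T.size := by
  induction T with
  | nil => simp
  | node A B C hA hB hC => simp [hA, hB, hC]; omega

/-! The word determines the tree: a stack parser. -/

/-- One step of a stack parser for words of ternary trees. -/
def parseStep : Tern × List Tern → DyckStep → Tern × List Tern
  | (T, st), U => (nil, T :: st)
  | (T₂, T₁ :: T₀ :: st), D => (T₀ ++ node T₁ T₂ nil, st)
  -- Stack underflow, which never occurs on the word of a ternary tree.
  | (T, st), D => (T, st)

/-- An arbitrary current tree and stack are carried along because the parts of a node are parsed
with open up-steps beneath them. -/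
lemma foldl_parseStep (S : Tern) (T : Tern) (st : List Tern) :
    S.word.foldl parseStep (T, st) = (T ++ S, st) := by
  induction S generalizing T st with
  | nil => simp
  | node A B C hA hB hC =>
    simp [List.foldl_append, hA, hB, hC, parseStep, append_assoc]

lemma word_injective : Function.Injective word := by
  intro S T h
  have h1 := foldl_parseStep S nil []
  rw [h, foldl_parseStep T nil []] at h1
  simpa using h1.symm

end Tern

open Tern

/-! ### Heights -/

@[simp] lemma height_nil : height [] = 0 := rfl

@[simp] lemma height_append (u v : List DyckStep) : height (u ++ v) = height u + height v := by
  simp [height]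

@[simp] lemma height_cons_U (u : List DyckStep) : height (U :: u) = 1 + height u := by
  simp [height, stepVal]

@[simp] lemma height_cons_D (u : List DyckStep) : height (D :: u) = -2 + height u := by
  simp [height, stepVal]

@[simp] lemma height_word (T : Tern) : height T.word = 0 := by
  induction T with
  | nil => simp
  | node A B C hA hB hC => simp [hA, hB, hC]

/-- The parts A, B, C of a node start at heights 1, 2 and 0. -/
lemma height_take_word_nonneg (T : Tern) (j : ℕ) : 0 ≤ height (T.word.take j) := by
  induction T generalizing j with
  | nil => simp
  | node A B C hA hB hC =>
    rcases j with _ | j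
    · simp
    rw [word_node, List.append_assoc, List.cons_append, List.cons_append, List.take_succ_cons,
      List.take_append, height_cons_U, height_append]
    rcases Nat.lt_or_ge A.word.length j with h | h
    · obtain ⟨k, hk⟩ : ∃ k, j - A.word.length = k + 1 := ⟨j - A.word.length - 1, by omega⟩
      rw [List.take_of_length_le h.le, hk, List.take_succ_cons, List.take_append, height_cons_U,
        height_append, height_word]
      rcases Nat.lt_or_ge B.word.length k with h' | h'
      · obtain ⟨l, hl⟩ : ∃ l, k - B.word.length = l + 1 := ⟨k - B.word.length - 1, by omega⟩
        rw [List.take_of_length_le h'.le, hl, List.take_succ_cons, height_cons_D, height_word]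
        linarith [hC l]
      · rw [Nat.sub_eq_zero_of_le h', List.take_zero, height_nil]
        linarith [hB k]
    · rw [Nat.sub_eq_zero_of_le h, List.take_zero, height_nil]
      linarith [hA j]

lemma height_prefix_nonneg {T : Tern} {P Q : List DyckStep} (h : T.word = P ++ Q) :
    0 ≤ height P := by
  simpa [h] using height_take_word_nonneg T P.length

lemma isTwoDyck_word (T : Tern) : IsTwoDyck T.word :=
  ⟨fun j _ => height_take_word_nonneg T j, height_word T⟩

/-- The word of a stack of ternary trees, the top first, with an open up-step above each. -/
def stackWord : List Tern → List DyckStep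
  | [] => []
  | T :: st => stackWord st ++ T.word ++ [U]

/-- A nonnegative path is a sequence of complete words separated by up-steps not yet closed, and its
height counts these; a down-step closes the last two. -/
lemma exists_stack (w : List DyckStep) (hw : ∀ j ≤ w.length, 0 ≤ height (w.take j)) :
    ∃ (T : Tern) (st : List Tern), stackWord st ++ T.word = w ∧ height w = st.length := by
  induction w using List.reverseRecOn with
  | nil => exact ⟨nil, [], by simp [stackWord]⟩
  | append_singleton w c ih =>
    obtain ⟨T, st, h, hh⟩ := ih fun j hj => by
      have := hw j (by simp; omega)
      rwa [List.take_append_of_le_length hj] at this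
    cases c with
    | U => exact ⟨nil, T :: st, by simp [stackWord, h], by simp [hh]⟩
    | D =>
      -- Nonnegativity after the down-step forces at least two open up-steps before it.
      have h0 := hw (w ++ [D]).length le_rfl
      rw [List.take_length] at h0
      simp [hh] at h0
      match st, h, hh, h0 with
      | [], h, hh, h0 => simp at h0
      | [_], h, hh, h0 => simp at h0
      | T₁ :: T₀ :: st, h, hh, h0 =>
        refine ⟨T₀ ++ node T₁ T nil, st, ?_, ?_⟩
        · rw [← h]
          simp [stackWord]
        · simp [hh]
          ring

lemma isTwoDyck_iff_exists_word {w : List DyckStep} : IsTwoDyck w ↔ ∃ T : Tern, T.word = w := by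
  constructor
  · rintro ⟨h, h0⟩
    obtain ⟨T, st, hw, hh⟩ := exists_stack w h
    have : st = [] := by
      rw [h0] at hh
      exact List.length_eq_zero_iff.1 (by exact_mod_cast hh.symm)
    subst this
    exact ⟨T, by simpa [stackWord] using hw⟩
  · rintro ⟨T, rfl⟩
    exact isTwoDyck_word T

/-- The first passage below the starting height splits uniquely. -/
lemma passage_unique {M M' R R' : Tern} {S S' : List DyckStep}
    (h : M.word ++ U :: R.word ++ D :: S = M'.word ++ U :: R'.word ++ D :: S') : M = M' := by
  have key : ∀ {M M' R R' : Tern} {S S' : List DyckStep},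
      M.word ++ U :: R.word ++ D :: S = M'.word ++ U :: R'.word ++ D :: S' →
      (M.word ++ U :: R.word).length ≤ (M'.word ++ U :: R'.word).length →
      (M.word ++ U :: R.word) = (M'.word ++ U :: R'.word) := by
    intro M M' R R' S S' h hl
    rcases List.append_eq_append_iff.1 h with ⟨c, hc, hc'⟩ | ⟨c, hc, hc'⟩
    · rcases c with _ | ⟨d, c⟩
      · simpa using hc.symm
      · exfalso
        simp only [List.cons_append, List.cons.injEq] at hc'
        obtain ⟨rfl, -⟩ := hc'
        -- The prefix M U R D has height -1, whereas no prefix of M' U R' goes below 0.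
        have h5 : (M'.word ++ U :: R'.word) = M.word ++ U :: R.word ++ [D] ++ c := by
          rw [hc]; simp
        rcases List.append_eq_append_iff.1 h5 with ⟨e, he, he'⟩ | ⟨e, he, he'⟩
        · rcases e with _ | ⟨d, e⟩
          · have := congrArg height he
            simp at this
          · simp only [List.cons_append, List.cons.injEq] at he'
            have h6 := height_prefix_nonneg he'.2
            have h7 := congrArg height he
            rw [← he'.1] at h7
            simp at h7
            omega
        · have h6 := height_prefix_nonneg he
          simp at h6
    · have := congrArg List.length hc
      have h0 : c.length = 0 := by
        simp only [List.length_append] at this hl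
        omega
      rw [List.length_eq_zero_iff.1 h0] at hc
      simpa using hc
  have h1 : M.word ++ U :: R.word = M'.word ++ U :: R'.word := by
    rcases le_total (M.word ++ U :: R.word).length (M'.word ++ U :: R'.word).length with hl | hl
    · exact key h hl
    · exact (key h.symm hl).symm
  -- Framed by U and D, the common prefix is the word of a single node, so injectivity of `word`
  -- recovers its first slot.
  have h2 : (node M R nil).word = (node M' R' nil).word := by
    have : U :: (M.word ++ U :: R.word) ++ [D] = U :: (M'.word ++ U :: R'.word) ++ [D] := by rw [h1]
    simpa using this
  have := word_injective h2
  injection this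

/-! ### Connectivity by a finite set of pairs -/

/-- `x` and `y` are joined by a path of edges in `E`. -/
def Conn (E : Finset (ℕ × ℕ)) : ℕ → ℕ → Prop := Relation.EqvGen fun x y => (x, y) ∈ E

namespace Conn

variable {E F : Finset (ℕ × ℕ)} {x y z : ℕ}

lemma refl (x : ℕ) : Conn E x x := Relation.EqvGen.refl x

lemma symm (h : Conn E x y) : Conn E y x := Relation.EqvGen.symm _ _ h

lemma trans (h : Conn E x y) (h' : Conn E y z) : Conn E x z := Relation.EqvGen.trans _ _ _ h h'

lemma of_mem (h : (x, y) ∈ E) : Conn E x y := Relation.EqvGen.rel _ _ h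

lemma mono (hEF : E ⊆ F) (h : Conn E x y) : Conn F x y :=
  Relation.EqvGen.mono (fun _ _ h => hEF h) _ _ h

/-- A property that no edge reachable from `x` breaks spreads from `x` along paths. -/
lemma induct {P : ℕ → Prop} (h : Conn E x y)
    (hP : ∀ u v, (u, v) ∈ E → Conn E x u → (P u ↔ P v)) (hx : P x) : P y := by
  have key : ∀ u v, Conn E u v → Conn E x u → (P u ↔ P v) := by
    intro u v huv
    induction huv with
    | rel u v h => exact hP u v h
    | refl u => intro _; rfl
    | symm u v h ih => intro hv; exact (ih (hv.trans (Conn.symm h))).symm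
    | trans u v w h1 h2 ih1 ih2 => intro hu; exact (ih1 hu).trans (ih2 (hu.trans h1))
  exact (key x y h (refl x)).1 hx

lemma insert_cases {e : ℕ × ℕ} (h : Conn (insert e E) x y) :
    Conn E x y ∨ (Conn E x e.1 ∧ Conn E e.2 y) ∨ (Conn E x e.2 ∧ Conn E e.1 y) := by
  obtain ⟨a, b⟩ := e
  have key : ∀ u v, Conn (insert (a, b) E) u v →
      Conn E u v ∨ (Conn E u a ∧ Conn E b v) ∨ (Conn E u b ∧ Conn E a v) := by
    intro u v huv
    induction huv with
    | rel u v h =>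
      rcases Finset.mem_insert.1 h with h | h
      · obtain ⟨rfl, rfl⟩ := Prod.mk.inj h
        exact Or.inr (Or.inl ⟨refl _, refl _⟩)
      · exact Or.inl (of_mem h)
    | refl u => exact Or.inl (refl u)
    | symm u v h ih =>
      rcases ih with h | ⟨h1, h2⟩ | ⟨h1, h2⟩
      · exact Or.inl h.symm
      · exact Or.inr (Or.inr ⟨h2.symm, h1.symm⟩)
      · exact Or.inr (Or.inl ⟨h2.symm, h1.symm⟩)
    | trans u v w _ _ ih1 ih2 =>
      rcases ih1 with h | ⟨h1, h2⟩ | ⟨h1, h2⟩ <;> rcases ih2 with k | ⟨k1, k2⟩ | ⟨k1, k2⟩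
      · exact Or.inl (h.trans k)
      · exact Or.inr (Or.inl ⟨h.trans k1, k2⟩)
      · exact Or.inr (Or.inr ⟨h.trans k1, k2⟩)
      · exact Or.inr (Or.inl ⟨h1, h2.trans k⟩)
      · exact Or.inr (Or.inl ⟨h1, k2⟩)
      · exact Or.inl (h1.trans k2)
      · exact Or.inr (Or.inr ⟨h1, h2.trans k⟩)
      · exact Or.inl (h1.trans k2)
      · exact Or.inr (Or.inr ⟨h1, k2⟩)
  exact key x y h

end Conn

/-- An edge merges at most two components: when `e` is inserted, it suffices to drop the
representative of the component of `e.1`. -/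
lemma exists_transversal (E : Finset (ℕ × ℕ)) (V : Finset ℕ) :
    ∃ R ⊆ V, (∀ x ∈ R, ∀ y ∈ R, Conn E x y → x = y) ∧ V.card ≤ R.card + E.card := by
  induction E using Finset.induction_on with
  | empty =>
    refine ⟨V, subset_rfl, fun x _ y _ h => ?_, by simp⟩
    exact (h.induct (P := fun z => x = z) (by simp) rfl)
  | insert e E he ih =>
    obtain ⟨R, hRV, hR, hc⟩ := ih
    have hcard : (R.filter fun x => Conn E x e.1).card ≤ 1 := by
      refine Finset.card_le_one.2 fun x hx y hy => ?_
      rw [Finset.mem_filter] at hx hy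
      exact hR x hx.1 y hy.1 (hx.2.trans hy.2.symm)
    refine ⟨R.filter fun x => ¬ Conn E x e.1, (Finset.filter_subset _ _).trans hRV, ?_, ?_⟩
    · intro x hx y hy h
      rw [Finset.mem_filter] at hx hy
      rcases h.insert_cases with h | h | h
      · exact hR x hx.1 y hy.1 h
      · exact absurd h.1 hx.2
      · exact absurd h.2.symm hy.2
    · have := Finset.card_filter_add_card_filter_not (s := R) (fun x => Conn E x e.1)
      rw [Finset.card_insert_of_notMem he]
      omega

lemma card_le_of_conn {E : Finset (ℕ × ℕ)} {V : Finset ℕ} {a : ℕ} (h : ∀ x ∈ V, Conn E a x) :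
    V.card ≤ E.card + 1 := by
  obtain ⟨R, hRV, hR, hc⟩ := exists_transversal E V
  have : R.card ≤ 1 := Finset.card_le_one.2 fun x hx y hy =>
    hR x hx y hy ((h x (hRV hx)).symm.trans (h y (hRV hy)))
  omega

/-! ### Non-crossing trees on intervals -/

/-- `E` is the edge set of a non-crossing spanning tree on the points `a, …, b`. -/
structure IsTreeOn (E : Finset (ℕ × ℕ)) (a b : ℕ) : Prop where
  range : ∀ e ∈ E, a ≤ e.1 ∧ e.1 < e.2 ∧ e.2 ≤ b
  nc : ∀ e ∈ E, ∀ e' ∈ E, ¬ (e.1 < e'.1 ∧ e'.1 < e.2 ∧ e.2 < e'.2)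
  conn : ∀ i, a ≤ i → i ≤ b → Conn E a i
  card : E.card + a = b

lemma card_of_conn {E : Finset (ℕ × ℕ)} {a b c : ℕ} (hab : a ≤ b)
    (h : ∀ i, a ≤ i → i ≤ b → Conn E c i) : b ≤ E.card + a := by
  have := card_le_of_conn (E := E) (V := Finset.Icc a b) (a := c)
    fun x hx => h x (Finset.mem_Icc.1 hx).1 (Finset.mem_Icc.1 hx).2
  rw [Nat.card_Icc] at this
  omega

section edgeGraph

variable {n : ℕ} {E : Finset (ℕ × ℕ)}

lemma edgeGraph_adj (hE : ∀ e ∈ E, e.1 < e.2 ∧ e.2 ≤ n) (i j : Fin (n + 1)) :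
    (edgeGraph n E).Adj i j ↔ ((i : ℕ), (j : ℕ)) ∈ E ∨ ((j : ℕ), (i : ℕ)) ∈ E := by
  rw [edgeGraph, SimpleGraph.fromRel_adj]
  refine ⟨fun h => h.2, fun h => ⟨?_, h⟩⟩
  rintro rfl
  rcases h with h | h <;> exact absurd (hE _ h).1 (lt_irrefl _)

lemma conn_of_reachable (hE : ∀ e ∈ E, e.1 < e.2 ∧ e.2 ≤ n) {i j : Fin (n + 1)}
    (h : (edgeGraph n E).Reachable i j) : Conn E i j := by
  obtain ⟨p⟩ := h
  induction p with
  | nil => exact Conn.refl _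
  | cons h _ ih =>
    rcases (edgeGraph_adj hE _ _).1 h with h | h
    · exact (Conn.of_mem h).trans ih
    · exact (Conn.of_mem h).symm.trans ih

lemma reachable_of_conn (hE : ∀ e ∈ E, e.1 < e.2 ∧ e.2 ≤ n) {i j : ℕ} (h : Conn E i j)
    (hi : i < n + 1) (hj : j < n + 1) : (edgeGraph n E).Reachable ⟨i, hi⟩ ⟨j, hj⟩ := by
  have := h.induct (P := fun k => ∃ hk : k < n + 1, (edgeGraph n E).Reachable ⟨i, hi⟩ ⟨k, hk⟩) ?_
    ⟨hi, SimpleGraph.Reachable.refl _⟩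
  · exact this.2
  intro u v huv _
  have hr := hE _ huv
  have hu : u < n + 1 := by simp at hr; omega
  have hv : v < n + 1 := by simp at hr; omega
  have hadj : (edgeGraph n E).Adj ⟨u, hu⟩ ⟨v, hv⟩ := (edgeGraph_adj hE _ _).2 (Or.inl huv)
  exact ⟨fun ⟨_, h⟩ => ⟨hv, h.trans hadj.reachable⟩,
    fun ⟨_, h⟩ => ⟨hu, h.trans hadj.symm.reachable⟩⟩

lemma card_edgeSet (hE : ∀ e ∈ E, e.1 < e.2 ∧ e.2 ≤ n) :
    Nat.card (edgeGraph n E).edgeSet = E.card := by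
  have h : ∀ e : E, e.1.1 < n + 1 ∧ e.1.2 < n + 1 := fun e => by
    have := hE e.1 e.2
    omega
  let φ : E → (edgeGraph n E).edgeSet := fun e =>
    ⟨s(⟨e.1.1, (h e).1⟩, ⟨e.1.2, (h e).2⟩), (edgeGraph_adj hE _ _).2 (Or.inl e.2)⟩
  have hφ : Function.Bijective φ := by
    constructor
    · rintro ⟨⟨a, b⟩, he⟩ ⟨⟨c, d⟩, he'⟩ hh
      have h1 := hE _ he
      have h2 := hE _ he'
      have hh := Sym2.eq_iff.1 (Subtype.mk.inj hh)
      simp only [Fin.mk.injEq] at hh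
      simp only at h1 h2
      rcases hh with ⟨rfl, rfl⟩ | ⟨rfl, rfl⟩
      · rfl
      · omega
    · rintro ⟨e, he⟩
      induction e using Sym2.ind with
      | _ i j =>
        rcases (edgeGraph_adj hE i j).1 he with h | h
        · exact ⟨⟨_, h⟩, rfl⟩
        · exact ⟨⟨_, h⟩, Subtype.ext (Sym2.eq_swap)⟩
  rw [← Nat.card_eq_of_bijective φ hφ]
  simp

/-- A connected graph is a tree exactly when it has one edge fewer than vertices, so acyclicity can
be traded for an edge count. -/
lemma isNCST_iff : IsNCST n E ↔ IsTreeOn E 0 n := by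
  constructor
  · rintro ⟨h1, h2, h3⟩
    have h4 := SimpleGraph.isTree_iff_connected_and_card.1 h3
    refine ⟨fun e he => ⟨Nat.zero_le _, h1 e he⟩, h2, fun i _ hi => ?_, ?_⟩
    · exact conn_of_reachable h1 (h4.1.preconnected ⟨0, by omega⟩ ⟨i, by omega⟩)
    · have := h4.2
      rw [card_edgeSet h1] at this
      simpa using this
  · rintro ⟨h1, h2, h3, h4⟩
    have h5 : ∀ e ∈ E, e.1 < e.2 ∧ e.2 ≤ n := fun e he => (h1 e he).2
    refine ⟨h5, h2, SimpleGraph.isTree_iff_connected_and_card.2 ⟨?_, ?_⟩⟩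
    · rw [SimpleGraph.connected_iff]
      refine ⟨fun i j => ?_, inferInstance⟩
      have h0 : ∀ k : Fin (n + 1), (edgeGraph n E).Reachable ⟨0, by omega⟩ k := fun k =>
        reachable_of_conn h5 (h3 k (Nat.zero_le _) (Nat.lt_succ_iff.1 k.2)) _ k.2
      exact (h0 i).symm.trans (h0 j)
    · rw [card_edgeSet h5]
      simpa using h4

end edgeGraph

/-! ### The tree of a ternary tree -/

namespace Tern

/-- The non-crossing tree of a ternary tree, on the points from `a` on. -/
def tree : Tern → ℕ → Finset (ℕ × ℕ)
  | nil, _ => ∅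
  | node A B C, a => insert (a, a + A.size + 1 + B.size)
      (A.tree a ∪ B.tree (a + A.size + 1) ∪ C.tree (a + A.size + 1 + B.size))

@[simp] lemma tree_nil (a : ℕ) : nil.tree a = ∅ := rfl

lemma tree_node (A B C : Tern) (a : ℕ) : (node A B C).tree a = insert (a, a + A.size + 1 + B.size)
      (A.tree a ∪ B.tree (a + A.size + 1) ∪ C.tree (a + A.size + 1 + B.size)) := rfl

lemma tree_append (S T : Tern) (a : ℕ) : (S ++ T).tree a = S.tree a ∪ T.tree (a + S.size) := by
  induction S generalizing a with
  | nil => simp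
  | node A B C _ _ ih =>
    rw [node_append, tree_node, tree_node, ih, size_node]
    have : a + A.size + 1 + B.size + C.size = a + (A.size + B.size + C.size + 1) := by ring
    rw [this, Finset.insert_union, Finset.union_assoc _ (C.tree _)]

lemma mem_tree_node {A B C : Tern} {a : ℕ} {e : ℕ × ℕ} : e ∈ (node A B C).tree a ↔
    e = (a, a + A.size + 1 + B.size) ∨ e ∈ A.tree a ∨ e ∈ B.tree (a + A.size + 1) ∨
      e ∈ C.tree (a + A.size + 1 + B.size) := by
  simp [tree_node]

lemma card_tree_le (T : Tern) (a : ℕ) : (T.tree a).card ≤ T.size := by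
  induction T generalizing a with
  | nil => simp
  | node A B C hA hB hC =>
    rw [tree_node, size_node]
    refine (Finset.card_insert_le _ _).trans ?_
    have h1 := Finset.card_union_le (A.tree a ∪ B.tree (a + A.size + 1))
      (C.tree (a + A.size + 1 + B.size))
    have h2 := Finset.card_union_le (A.tree a) (B.tree (a + A.size + 1))
    have := hA a
    have := hB (a + A.size + 1)
    have := hC (a + A.size + 1 + B.size)
    omega

lemma range_tree (T : Tern) (a : ℕ) : ∀ e ∈ T.tree a, a ≤ e.1 ∧ e.1 < e.2 ∧ e.2 ≤ a + T.size := by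
  induction T generalizing a with
  | nil => simp
  | node A B C hA hB hC =>
    intro e he
    rw [size_node]
    rcases mem_tree_node.1 he with rfl | h | h | h
    · simp only; omega
    · have := hA _ e h; omega
    · have := hB _ e h; omega
    · have := hC _ e h; omega

lemma conn_tree (T : Tern) (a i : ℕ) (h1 : a ≤ i) (h2 : i ≤ a + T.size) :
    Conn (T.tree a) a i := by
  induction T generalizing a i with
  | nil =>
    obtain rfl : i = a := by simp at h2; omega
    exact Conn.refl _
  | node A B C hA hB hC =>
    rw [size_node] at h2
    have ht : Conn ((node A B C).tree a) a (a + A.size + 1 + B.size) :=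
      Conn.of_mem (mem_tree_node.2 (Or.inl rfl))
    have sA : A.tree a ⊆ (node A B C).tree a := fun e he => mem_tree_node.2 (by tauto)
    have sB : B.tree (a + A.size + 1) ⊆ (node A B C).tree a := fun e he =>
      mem_tree_node.2 (by tauto)
    have sC : C.tree (a + A.size + 1 + B.size) ⊆ (node A B C).tree a := fun e he =>
      mem_tree_node.2 (by tauto)
    rcases Nat.lt_or_ge (a + A.size) i with h | h
    · rcases Nat.lt_or_ge (a + A.size + 1 + B.size) i with h' | h'
      · exact ht.trans ((hC _ i (by omega) (by omega)).mono sC)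
      · exact ht.trans (((hB _ _ (by omega) le_rfl).symm.trans (hB _ i (by omega) h')).mono sB)
    · exact (hA a i h1 h).mono sA

lemma isTreeOn_tree (T : Tern) (a : ℕ) : IsTreeOn (T.tree a) a (a + T.size) := by
  refine ⟨range_tree T a, ?_, conn_tree T a, ?_⟩
  · induction T generalizing a with
    | nil => simp
    | node A B C hA hB hC =>
      intro e he e' he'
      rcases mem_tree_node.1 he with rfl | h | h | h <;>
      rcases mem_tree_node.1 he' with rfl | h' | h' | h'
      · simp
      · have := range_tree _ _ _ h'; simp only; omega
      · have := range_tree _ _ _ h'; simp only; omega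
      · have := range_tree _ _ _ h'; simp only; omega
      · have := range_tree _ _ _ h; simp only; omega
      · exact hA _ e h e' h'
      · have := range_tree _ _ _ h; have := range_tree _ _ _ h'; omega
      · have := range_tree _ _ _ h; have := range_tree _ _ _ h'; omega
      · have := range_tree _ _ _ h; simp only; omega
      · have := range_tree _ _ _ h; have := range_tree _ _ _ h'; omega
      · exact hB _ e h e' h'
      · have := range_tree _ _ _ h; have := range_tree _ _ _ h'; omega
      · have := range_tree _ _ _ h; simp only; omega
      · have := range_tree _ _ _ h; have := range_tree _ _ _ h'; omega
      · have := range_tree _ _ _ h; have := range_tree _ _ _ h'; omega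
      · exact hC _ e h e' h'
  · have h1 := card_tree_le T a
    have h2 := card_of_conn (Nat.le_add_right a T.size) (conn_tree T a)
    omega

lemma card_tree (T : Tern) (a : ℕ) : (T.tree a).card = T.size := by
  have := (isTreeOn_tree T a).card
  omega

end Tern

open Tern

/-! ### The tree determines the ternary tree -/

/-- If no edge of `E` leaves `[a, c]`, a tree contained in `E` and starting at `a` fits there. -/
lemma size_le_of_tree_subset {A : Tern} {a c : ℕ} {E : Finset (ℕ × ℕ)}
    (hE : ∀ e ∈ E, e.1 ≤ c ↔ e.2 ≤ c) (h : A.tree a ⊆ E) (hc : a ≤ c) : a + A.size ≤ c := by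
  have h1 := (conn_tree A a (a + A.size) (by omega) le_rfl).mono h
  exact h1.induct (P := fun x => x ≤ c) (fun u v huv _ => hE _ huv) hc

lemma tree_left_eq_filter (A B C : Tern) (a : ℕ) : A.tree a =
    ((node A B C).tree a).filter fun e => e.2 ≤ a + A.size := by
  ext e
  rw [Finset.mem_filter, mem_tree_node]
  constructor
  · intro h
    have := range_tree _ _ _ h
    exact ⟨by tauto, by omega⟩
  · rintro ⟨rfl | h | h | h, h'⟩
    · simp at h'; try omega
    · exact h
    · have := range_tree _ _ _ h; omega
    · have := range_tree _ _ _ h; omega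

lemma tree_mid_eq_filter (A B C : Tern) (a : ℕ) : B.tree (a + A.size + 1) =
    ((node A B C).tree a).filter fun e => a + A.size + 1 ≤ e.1 ∧ e.2 ≤ a + A.size + 1 + B.size := by
  ext e
  rw [Finset.mem_filter, mem_tree_node]
  constructor
  · intro h
    have := range_tree _ _ _ h
    exact ⟨by tauto, by omega⟩
  · rintro ⟨rfl | h | h | h, h'⟩
    · simp at h'; try omega
    · have := range_tree _ _ _ h; omega
    · exact h
    · have := range_tree _ _ _ h; omega

lemma tree_right_eq_filter (A B C : Tern) (a : ℕ) : C.tree (a + A.size + 1 + B.size) =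
    ((node A B C).tree a).filter fun e => a + A.size + 1 + B.size ≤ e.1 := by
  ext e
  rw [Finset.mem_filter, mem_tree_node]
  constructor
  · intro h
    have := range_tree _ _ _ h
    exact ⟨by tauto, by omega⟩
  · rintro ⟨rfl | h | h | h, h'⟩
    · simp at h'; try omega
    · have := range_tree _ _ _ h; omega
    · have := range_tree _ _ _ h; omega
    · exact h

lemma tree_injective {S T : Tern} {a : ℕ} (h : S.tree a = T.tree a) : S = T := by
  induction S generalizing T a with
  | nil =>
    cases T with
    | nil => rfl
    | node A B C =>
      have := congrArg Finset.card h
      simp [card_tree] at this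
  | node A B C hA hB hC =>
    cases T with
    | nil =>
      have := congrArg Finset.card h
      simp [card_tree] at this
    | node A' B' C' =>
      have ht : a + A.size + 1 + B.size = a + A'.size + 1 + B'.size := by
        -- The right end of the pivot edge is the largest neighbour of `a`.
        have key : ∀ {A B C A' B' C' : Tern}, (node A B C).tree a = (node A' B' C').tree a →
            a + A.size + 1 + B.size ≤ a + A'.size + 1 + B'.size := by
          intro A B C A' B' C' h
          have h1 : (a, a + A.size + 1 + B.size) ∈ (node A' B' C').tree a := by
            rw [← h]; exact mem_tree_node.2 (Or.inl rfl)
          rcases mem_tree_node.1 h1 with h | h | h | h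
          · simp at h; exact h.le
          · have := range_tree _ _ _ h; simp only at this; omega
          · have := range_tree _ _ _ h; simp only at this; omega
          · have := range_tree _ _ _ h; simp only at this; omega
        exact le_antisymm (key h) (key h.symm)
      have hs : A.size = A'.size := by
        -- No edge other than the pivot leaves `[a, a + A.size]`, and the connected part `A'` starts
        -- at `a` and avoids the pivot.
        have key : ∀ {A B C A' B' C' : Tern}, (node A B C).tree a = (node A' B' C').tree a →
            a + A.size + 1 + B.size = a + A'.size + 1 + B'.size → A'.size ≤ A.size := by
          intro A B C A' B' C' h ht
          have := size_le_of_tree_subset (A := A') (a := a) (c := a + A.size)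
            (E := ((node A B C).tree a).erase (a, a + A.size + 1 + B.size)) ?_ ?_ (by omega)
          · omega
          · intro e he
            rw [Finset.mem_erase, mem_tree_node] at he
            rcases he with ⟨hne, h | h | h | h⟩
            · exact absurd h hne
            · have := range_tree _ _ _ h; omega
            · have := range_tree _ _ _ h; omega
            · have := range_tree _ _ _ h; omega
          · intro e he
            rw [h, Finset.mem_erase]
            refine ⟨?_, mem_tree_node.2 (Or.inr (Or.inl he))⟩
            rintro rfl
            have := range_tree _ _ _ he
            simp at this
            omega
        exact le_antisymm (key h.symm ht.symm) (key h ht)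
      have hs' : B.size = B'.size := by omega
      have hA' : A = A' := by
        refine hA (a := a) ?_
        rw [tree_left_eq_filter A B C, tree_left_eq_filter A' B' C', h, hs]
      have hB' : B = B' := by
        refine hB (a := a + A.size + 1) ?_
        conv_rhs => rw [hs]
        rw [tree_mid_eq_filter A B C, tree_mid_eq_filter A' B' C', h, hs, hs']
      have hC' : C = C' := by
        refine hC (a := a + A.size + 1 + B.size) ?_
        conv_rhs => rw [hs, hs']
        rw [tree_right_eq_filter A B C, tree_right_eq_filter A' B' C', h, hs, hs']
      rw [hA', hB', hC']

/-! ### Every non-crossing tree comes from a ternary tree -/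

lemma exists_pivot {E : Finset (ℕ × ℕ)} {a b : ℕ}
    (hr : ∀ e ∈ E, a ≤ e.1 ∧ e.1 < e.2 ∧ e.2 ≤ b) (hconn : ∀ i, a ≤ i → i ≤ b → Conn E a i)
    (hab : a < b) : ∃ t, (a, t) ∈ E ∧ ∀ t', (a, t') ∈ E → t' ≤ t := by
  have hne : ((E.filter fun e => e.1 = a).image Prod.snd).Nonempty := by
    by_contra hne
    rw [Finset.not_nonempty_iff_eq_empty, Finset.image_eq_empty, Finset.filter_eq_empty_iff] at hne
    have := (hconn b hab.le le_rfl).induct (P := fun x => x = a) (fun u v huv _ => ?_) rfl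
    · omega
    · have h1 := hr _ huv
      have h2 := hne huv
      simp only at h1 h2
      omega
  refine ⟨Finset.max' _ hne, ?_, fun t' ht' => Finset.le_max' _ t' ?_⟩
  · obtain ⟨e, he, he'⟩ := Finset.mem_image.1 (Finset.max'_mem _ hne)
    rw [Finset.mem_filter] at he
    rw [← he', ← he.2]
    exact he.1
  · exact Finset.mem_image.2 ⟨(a, t'), Finset.mem_filter.2 ⟨ht', rfl⟩, rfl⟩

/-- Beneath the pivot edge the points `a, …, s` stay connected and no edge leaves them. -/
lemma exists_cut {E : Finset (ℕ × ℕ)} {a b : ℕ} (hE : IsTreeOn E a b) (hab : a < b) :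
    ∃ s t F, a ≤ s ∧ s < t ∧ t ≤ b ∧ E = insert (a, t) F ∧ F.card + 1 = E.card ∧
      (∀ e ∈ F, e.2 ≤ t ∨ t ≤ e.1) ∧ (∀ e ∈ F, e.1 ≤ s ↔ e.2 ≤ s) ∧
      (∀ i, a ≤ i → i ≤ s → Conn F a i) ∧ ∀ i, s < i → i ≤ b → Conn F t i := by
  obtain ⟨hr, hnc, hconn, hcard⟩ := hE
  obtain ⟨t, hat, hmax⟩ := exists_pivot hr hconn hab
  have htr := hr _ hat
  simp only at htr
  set F := E.erase (a, t) with hF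
  have hFE : F ⊆ E := Finset.erase_subset _ _
  have hEF : E = insert (a, t) F := (Finset.insert_erase hat).symm
  have hFcard : F.card + 1 = E.card := Finset.card_erase_add_one hat
  -- without the pivot edge, `t` is not reached from `a`
  have hta : ¬ Conn F a t := by
    intro h
    have := card_of_conn (E := F) (c := a) hab.le fun i h1 h2 => by
      have h3 := hconn i h1 h2
      rw [hEF] at h3
      rcases h3.insert_cases with h3 | ⟨_, h3⟩ | ⟨h3, h4⟩
      · exact h3
      · exact h.trans h3
      · exact h4
    omega
  have hor : ∀ i, a ≤ i → i ≤ b → Conn F a i ∨ Conn F t i := by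
    intro i h1 h2
    have h3 := hconn i h1 h2
    rw [hEF] at h3
    rcases h3.insert_cases with h3 | ⟨_, h3⟩ | ⟨h3, h4⟩
    · exact Or.inl h3
    · exact Or.inr h3
    · exact Or.inl h4
  -- no edge passes over `t`
  have hover : ∀ e ∈ F, e.2 ≤ t ∨ t ≤ e.1 := by
    intro e he
    by_contra! h
    have h1 := hr e (hFE he)
    have h2 := hnc _ hat e (hFE he)
    simp only at h2
    have h3 : e.1 = a := by omega
    have := hmax e.2 (by rw [← h3]; exact hFE he)
    omega
  obtain ⟨s, has, hst, hs, hs1⟩ : ∃ s, a ≤ s ∧ s < t ∧ (∀ i, a ≤ i → i ≤ s → Conn F a i) ∧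
      ¬ Conn F a (s + 1) := by
    have hex : ∃ k, ¬ Conn F a (a + k) := ⟨t - a, by rwa [Nat.add_sub_cancel' htr.2.1.le]⟩
    have h0 : Nat.find hex ≠ 0 := by
      intro h
      have := Nat.find_spec hex
      rw [h] at this
      exact this (Conn.refl _)
    have hle : Nat.find hex ≤ t - a :=
      Nat.find_min' hex (by rwa [Nat.add_sub_cancel' htr.2.1.le])
    refine ⟨a + (Nat.find hex - 1), by omega, by omega, fun i h1 h2 => ?_, ?_⟩
    · have := Nat.find_min hex (m := i - a) (by omega)
      rwa [not_not, Nat.add_sub_cancel' h1] at this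
    · have := Nat.find_spec hex
      rwa [show a + (Nat.find hex - 1) + 1 = a + Nat.find hex by omega]
  -- no edge leaves `[a, s]`
  have hcut : ∀ e ∈ F, e.1 ≤ s ↔ e.2 ≤ s := by
    rintro ⟨x, y⟩ he
    have h1 := hr _ (hFE he)
    simp only at h1 ⊢
    refine ⟨fun hx => ?_, fun h => by omega⟩
    by_contra! hy
    have hxK := hs x h1.1 hx
    have hyK : Conn F a y := hxK.trans (Conn.of_mem he)
    have hy1 : y ≠ s + 1 := by rintro rfl; exact hs1 hyK
    have hyt : y ≠ t := by rintro rfl; exact hta hyK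
    have hov := hover _ he
    simp only at hov
    have h2 : Conn F (s + 1) t := by
      rcases hor (s + 1) (by omega) (by omega) with h | h
      · exact absurd h hs1
      · exact h.symm
    -- A path from `s + 1` to `t` avoids `x` and `y`, which lie in the component of `a`, and cannot
    -- cross the edge `(x, y)`. So `t` lies strictly beneath that edge, against `hover`.
    have h3 := h2.induct (P := fun z => x < z ∧ z < y) (fun u v huv hu => ?_) (by omega)
    · omega
    · have huK : ¬ Conn F a u := fun h => hs1 (h.trans hu.symm)
      have hvK : ¬ Conn F a v := fun h => hs1 (h.trans (hu.trans (Conn.of_mem huv)).symm)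
      have n1 : u ≠ x := by rintro rfl; exact huK hxK
      have n2 : u ≠ y := by rintro rfl; exact huK hyK
      have n3 : v ≠ x := by rintro rfl; exact hvK hxK
      have n4 : v ≠ y := by rintro rfl; exact hvK hyK
      have c1 := hnc _ (hFE he) _ (hFE huv)
      have c2 := hnc _ (hFE huv) _ (hFE he)
      have c3 := hr _ (hFE huv)
      simp only at c1 c2 c3
      omega
  have hnK : ∀ i, s < i → i ≤ b → Conn F t i := by
    intro i h1 h2
    refine (hor i (by omega) h2).resolve_left fun h => ?_
    have := h.induct (P := fun x => x ≤ s) (fun u v huv _ => hcut _ huv) has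
    omega
  exact ⟨s, t, F, has, hst, htr.2.2, hEF, hFcard, hover, hcut, hs, hnK⟩

lemma exists_split {E : Finset (ℕ × ℕ)} {a b : ℕ} (hE : IsTreeOn E a b) (hab : a < b) :
    ∃ s t EA EB EC, a ≤ s ∧ s < t ∧ IsTreeOn EA a s ∧ IsTreeOn EB (s + 1) t ∧
      IsTreeOn EC t b ∧ E = insert (a, t) (EA ∪ EB ∪ EC) := by
  obtain ⟨s, t, F, has, hst, htb, hEF, hFcard, hover, hcut, hs, hnK⟩ := exists_cut hE hab
  obtain ⟨hr, hnc, hconn, hcard⟩ := hE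
  have hFE : F ⊆ E := by rw [hEF]; exact Finset.subset_insert _ _
  obtain ⟨EA, hEA⟩ : ∃ EA, EA = F.filter fun e => e.2 ≤ s := ⟨_, rfl⟩
  obtain ⟨EB, hEB⟩ : ∃ EB, EB = F.filter fun e => s < e.1 ∧ e.2 ≤ t := ⟨_, rfl⟩
  obtain ⟨EC, hEC⟩ : ∃ EC, EC = F.filter fun e => t ≤ e.1 := ⟨_, rfl⟩
  have mA : ∀ e, e ∈ EA ↔ e ∈ F ∧ e.2 ≤ s := by simp [hEA]
  have mB : ∀ e, e ∈ EB ↔ e ∈ F ∧ s < e.1 ∧ e.2 ≤ t := by simp [hEB]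
  have mC : ∀ e, e ∈ EC ↔ e ∈ F ∧ t ≤ e.1 := by simp [hEC]
  have hcover : F = EA ∪ EB ∪ EC := by
    ext e
    simp only [mA, mB, mC, Finset.mem_union]
    constructor
    · intro he
      have h1 := hcut e he
      have h2 := hover e he
      rcases h2 with h2 | h2
      · rcases Nat.lt_or_ge s e.2 with h3 | h3
        · exact Or.inl (Or.inr ⟨he, by omega, h2⟩)
        · exact Or.inl (Or.inl ⟨he, h3⟩)
      · exact Or.inr ⟨he, h2⟩
    · tauto
  have cA : ∀ i, a ≤ i → i ≤ s → Conn EA a i := by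
    intro i h1 h2
    have := (hs i h1 h2).induct (P := fun x => x ≤ s → Conn EA a x) (fun u v huv _ => ?_)
      (fun _ => Conn.refl _)
    · exact this h2
    · have h3 := hcut _ huv
      simp only at h3
      rcases Nat.lt_or_ge s v with h4 | h4
      · constructor <;> intro <;> intro <;> omega
      · have : Conn EA u v := Conn.of_mem ((mA _).2 ⟨huv, h4⟩)
        exact ⟨fun h h' => (h (h3.2 h')).trans this, fun h h' => (h (h3.1 h')).trans this.symm⟩
  have cB : ∀ i, s + 1 ≤ i → i ≤ t → Conn EB t i := by
    intro i h1 h2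
    have := (hnK i h1 (by omega)).induct (P := fun x => s < x → x ≤ t → Conn EB t x)
      (fun u v huv _ => ?_) (fun _ _ => Conn.refl _)
    · exact this h1 h2
    · have h3 := hcut _ huv
      have h4 := hover _ huv
      have h5 := hr _ (hFE huv)
      simp only at h3 h4 h5
      rcases h4 with h4 | h4
      · rcases Nat.lt_or_ge s u with h6 | h6
        · have : Conn EB u v := Conn.of_mem ((mB _).2 ⟨huv, h6, h4⟩)
          exact ⟨fun h h' h'' => (h (by omega) (by omega)).trans this,
            fun h h' h'' => (h (by omega) (by omega)).trans this.symm⟩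
        · constructor <;> intro <;> intro <;> omega
      · constructor
        · intro _ _ _; omega
        · intro _ _ h
          obtain rfl : u = t := by omega
          exact Conn.refl _
  have cC : ∀ i, t ≤ i → i ≤ b → Conn EC t i := by
    intro i h1 h2
    have := (hnK i (by omega) (by omega)).induct (P := fun x => t ≤ x → Conn EC t x)
      (fun u v huv _ => ?_) (fun _ => Conn.refl _)
    · exact this h1
    · have h4 := hover _ huv
      have h5 := hr _ (hFE huv)
      simp only at h4 h5
      rcases h4 with h4 | h4
      · constructor
        · intro _ h
          obtain rfl : v = t := by omega
          exact Conn.refl _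
        · intro _ _; omega
      · have : Conn EC u v := Conn.of_mem ((mC _).2 ⟨huv, h4⟩)
        exact ⟨fun h h' => (h h4).trans this, fun h h' => (h (by omega)).trans this.symm⟩
  -- The three lower bounds add up to exactly the number of edges of `F`, so each of them is an
  -- equality.
  have kA := card_of_conn has cA
  have kB := card_of_conn (show s + 1 ≤ t by omega) cB
  have kC := card_of_conn htb cC
  have ktot : EA.card + EB.card + EC.card = F.card := by
    have d1 : Disjoint EA EB := Finset.disjoint_left.2 fun e h1 h2 => by
      have h1 := (mA e).1 h1
      have h2 := (mB e).1 h2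
      have := hr e (hFE h1.1)
      omega
    have d2 : Disjoint (EA ∪ EB) EC := Finset.disjoint_left.2 fun e h1 h2 => by
      have h2 := (mC e).1 h2
      have := hr e (hFE h2.1)
      rcases Finset.mem_union.1 h1 with h1 | h1
      · have := (mA e).1 h1
        omega
      · have := (mB e).1 h1
        omega
    rw [← Finset.card_union_of_disjoint d1, ← Finset.card_union_of_disjoint d2, ← hcover]
  refine ⟨s, t, EA, EB, EC, has, hst, ⟨fun e he => ?_, fun e he e' he' => ?_, cA, by omega⟩,
    ⟨fun e he => ?_, fun e he e' he' => ?_,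
      fun i h1 h2 => (cB (s + 1) le_rfl (by omega)).symm.trans (cB i h1 h2), by omega⟩,
    ⟨fun e he => ?_, fun e he e' he' => ?_, cC, by omega⟩, by rw [← hcover, hEF]⟩
  · have h2 := (mA e).1 he
    have h1 := hr e (hFE h2.1)
    exact ⟨h1.1, h1.2.1, h2.2⟩
  · exact hnc e (hFE ((mA e).1 he).1) e' (hFE ((mA e').1 he').1)
  · have h2 := (mB e).1 he
    have h1 := hr e (hFE h2.1)
    exact ⟨h2.2.1, h1.2.1, h2.2.2⟩
  · exact hnc e (hFE ((mB e).1 he).1) e' (hFE ((mB e').1 he').1)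
  · have h2 := (mC e).1 he
    have h1 := hr e (hFE h2.1)
    exact ⟨h2.2, h1.2.1, h1.2.2⟩
  · exact hnc e (hFE ((mC e).1 he).1) e' (hFE ((mC e').1 he').1)

lemma exists_tern_of_isTreeOn {E : Finset (ℕ × ℕ)} {a b : ℕ} (hE : IsTreeOn E a b) :
    ∃ T : Tern, T.tree a = E ∧ a + T.size = b := by
  have hle : a ≤ b := by have := hE.card; omega
  obtain ⟨m, hm⟩ : ∃ m, b - a = m := ⟨_, rfl⟩
  induction m using Nat.strong_induction_on generalizing E a b with
  | _ m ih =>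
    rcases hle.eq_or_lt with rfl | hab
    · have h0 : E = ∅ := Finset.card_eq_zero.1 (by have := hE.card; omega)
      exact ⟨nil, by simp [h0], by simp⟩
    · obtain ⟨s, t, EA, EB, EC, has, hst, hA, hB, hC, rfl⟩ := exists_split hE hab
      have htb : t ≤ b := by have := hC.card; omega
      obtain ⟨A, rfl, hAs⟩ := ih (s - a) (by omega) hA has rfl
      obtain ⟨B, rfl, hBs⟩ := ih (t - (s + 1)) (by omega) hB hst rfl
      obtain ⟨C, rfl, hCs⟩ := ih (b - t) (by omega) hC htb rfl
      refine ⟨node A B C, ?_, by rw [size_node]; omega⟩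
      rw [tree_node, hAs, hBs]

/-! ### The correspondence -/

lemma corresponds_iff {w : List DyckStep} {a b : ℕ} {E : Finset (ℕ × ℕ)} :
    Corresponds w a b E ↔ ∃ T : Tern, T.word = w ∧ a + T.size = b ∧ T.tree a = E := by
  constructor
  · intro h
    induction h with
    | empty a => exact ⟨nil, rfl, rfl, rfl⟩
    | node _ _ _ hA hB hC =>
      obtain ⟨A, rfl, hA, rfl⟩ := hA
      obtain ⟨B, rfl, hB, rfl⟩ := hB
      obtain ⟨C, rfl, hC, rfl⟩ := hC
      exact ⟨node A B C, rfl, by rw [size_node]; omega, by rw [tree_node, hA, hB]⟩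
  · rintro ⟨T, rfl, rfl, rfl⟩
    induction T generalizing a with
    | nil => exact Corresponds.empty a
    | node A B C hA hB hC =>
      have := Corresponds.node (@hA a) (@hB (a + A.size + 1)) (@hC (a + A.size + 1 + B.size))
      rw [tree_node, word_node, size_node]
      convert this using 1
      ring

/-- The 2-Dyck path of a ternary tree with `n` nodes. -/
def toPath {n : ℕ} (T : Tern) (hT : T.size = n) : TwoDyck n :=
  ⟨T.word, by rw [length_word, hT], isTwoDyck_word T⟩

lemma exists_tern {n : ℕ} (X : TwoDyck n) : ∃ T : Tern, T.word = X.1 ∧ T.size = n := by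
  obtain ⟨T, hT⟩ := isTwoDyck_iff_exists_word.1 X.2.2
  refine ⟨T, hT, ?_⟩
  have := X.2.1
  rw [← hT, length_word] at this
  omega

/-- The ternary tree of a 2-Dyck path. -/
def ternOf {n : ℕ} (X : TwoDyck n) : Tern := (exists_tern X).choose

@[simp] lemma word_ternOf {n : ℕ} (X : TwoDyck n) : (ternOf X).word = X.1 :=
  (exists_tern X).choose_spec.1

@[simp] lemma size_ternOf {n : ℕ} (X : TwoDyck n) : (ternOf X).size = n :=
  (exists_tern X).choose_spec.2

lemma isNCST_tree {n : ℕ} {T : Tern} (hT : T.size = n) : IsNCST n (T.tree 0) := by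
  have := isTreeOn_tree T 0
  rw [hT, zero_add] at this
  exact isNCST_iff.2 this

/-- The non-crossing spanning tree of a 2-Dyck path. -/
def toTree {n : ℕ} (X : TwoDyck n) : NCST n := ⟨(ternOf X).tree 0, isNCST_tree (size_ternOf X)⟩

lemma toTree_bijective (n : ℕ) : Function.Bijective (toTree (n := n)) := by
  constructor
  · intro X Y h
    have := tree_injective (Subtype.mk.inj h)
    exact Subtype.ext (by rw [← word_ternOf X, this, word_ternOf])
  · rintro ⟨E, hE⟩
    obtain ⟨T, rfl, hT⟩ := exists_tern_of_isTreeOn (isNCST_iff.1 hE)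
    rw [zero_add] at hT
    refine ⟨toPath T hT, Subtype.ext ?_⟩
    have : ternOf (toPath T hT) = T := word_injective (by simp [toPath])
    simp [toTree, this]

/-- The correspondence of paths and trees as a bijection. -/
def treeEquiv (n : ℕ) : TwoDyck n ≃ NCST n := Equiv.ofBijective toTree (toTree_bijective n)

lemma treeEquiv_eq_iff {n : ℕ} (X : TwoDyck n) (T : NCST n) :
    treeEquiv n X = T ↔ Corresponds X.1 0 n T.1 := by
  rw [corresponds_iff]
  constructor
  · rintro rfl
    exact ⟨ternOf X, by simp, by simp, rfl⟩
  · rintro ⟨S, hS, -, hT⟩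
    have : ternOf X = S := word_injective (by simp [hS])
    exact Subtype.ext (by rw [← hT, ← this]; rfl)

/-! ### Flips of ternary trees -/

/-- The trees of `S` and `T` differ in at most one edge. -/
def Flip (S T : Tern) : Prop :=
  S.size = T.size ∧ ∀ a, ∃ F e e', S.tree a = insert e F ∧ T.tree a = insert e' F

namespace Flip

lemma symm {S T : Tern} (h : Flip S T) : Flip T S :=
  ⟨h.1.symm, fun a => by obtain ⟨F, e, e', h1, h2⟩ := h.2 a; exact ⟨F, e', e, h2, h1⟩⟩

/-- Equal sizes keep the other parts on the same points, so the pivot edge and these parts join the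
common forest. -/
lemma node_left {S T : Tern} (h : Flip S T) (B C : Tern) : Flip (node S B C) (node T B C) := by
  refine ⟨by simp [h.1], fun a => ?_⟩
  obtain ⟨F, e, e', h1, h2⟩ := h.2 a
  refine ⟨insert (a, a + T.size + 1 + B.size)
    (F ∪ B.tree (a + T.size + 1) ∪ C.tree (a + T.size + 1 + B.size)), e, e', ?_, ?_⟩
  · rw [tree_node, h.1, h1, Finset.insert_union, Finset.insert_union, Finset.insert_comm]
  · rw [tree_node, h2, Finset.insert_union, Finset.insert_union, Finset.insert_comm]

lemma node_mid {S T : Tern} (h : Flip S T) (A C : Tern) : Flip (node A S C) (node A T C) := by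
  refine ⟨by simp [h.1], fun a => ?_⟩
  obtain ⟨F, e, e', h1, h2⟩ := h.2 (a + A.size + 1)
  refine ⟨insert (a, a + A.size + 1 + T.size)
    (A.tree a ∪ F ∪ C.tree (a + A.size + 1 + T.size)), e, e', ?_, ?_⟩
  · rw [tree_node, h.1, h1, Finset.union_insert, Finset.insert_union, Finset.insert_comm]
  · rw [tree_node, h2, Finset.union_insert, Finset.insert_union, Finset.insert_comm]

lemma node_right {S T : Tern} (h : Flip S T) (A B : Tern) : Flip (node A B S) (node A B T) := by
  refine ⟨by simp [h.1], fun a => ?_⟩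
  obtain ⟨F, e, e', h1, h2⟩ := h.2 (a + A.size + 1 + B.size)
  refine ⟨insert (a, a + A.size + 1 + B.size)
    (A.tree a ∪ B.tree (a + A.size + 1) ∪ F), e, e', ?_, ?_⟩
  · rw [tree_node, h1, Finset.union_insert, Finset.insert_comm]
  · rw [tree_node, h2, Finset.union_insert, Finset.insert_comm]

lemma append_left {S T : Tern} (h : Flip S T) (L : Tern) : Flip (L ++ S) (L ++ T) := by
  induction L with
  | nil => exact h
  | node A B C _ _ ih => exact ih.node_right A B

/-- Turning the pivot edge about its left end. -/
lemma pivot_left (A B M C : Tern) : Flip (node A (B ++ M) C) (node A B (M ++ C)) := by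
  refine ⟨by simp; omega, fun a => ⟨A.tree a ∪ B.tree (a + A.size + 1) ∪
    M.tree (a + A.size + 1 + B.size) ∪ C.tree (a + A.size + 1 + B.size + M.size),
    (a, a + A.size + 1 + B.size + M.size), (a, a + A.size + 1 + B.size), ?_, ?_⟩⟩
  · rw [tree_node, tree_append, size_append, ← Nat.add_assoc (a + A.size + 1),
      ← Finset.union_assoc (A.tree a)]
  · rw [tree_node, tree_append, ← Finset.union_assoc]

/-- Turning the pivot edge about its right end. -/
lemma pivot_right (M A B C : Tern) : Flip (node (M ++ A) B C) (M ++ node A B C) := by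
  refine ⟨by simp; omega, fun a => ⟨M.tree a ∪ A.tree (a + M.size) ∪
    B.tree (a + M.size + A.size + 1) ∪ C.tree (a + M.size + A.size + 1 + B.size),
    (a, a + M.size + A.size + 1 + B.size), (a + M.size, a + M.size + A.size + 1 + B.size), ?_, ?_⟩⟩
  · rw [tree_node, tree_append, size_append, ← Nat.add_assoc a]
  · rw [tree_append, tree_node, Finset.union_insert, Finset.union_assoc, Finset.union_assoc,
      Finset.union_assoc]

/-- Replacing the pivot edge by the edge across the gap beneath it. -/
lemma pivot_gap (A B C : Tern) : Flip (node A B C) (A ++ node nil nil (B ++ C)) := by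
  refine ⟨by simp; omega, fun a => ⟨A.tree a ∪ B.tree (a + A.size + 1) ∪
    C.tree (a + A.size + 1 + B.size), (a, a + A.size + 1 + B.size),
    (a + A.size, a + A.size + 1), rfl, ?_⟩⟩
  rw [tree_append, tree_node, tree_append]
  simp [Finset.union_assoc]

/-- Moving the gap beneath the pivot edge. -/
lemma gap_move (A M B C : Tern) :
    Flip (node (A ++ node nil nil M) B C) (node A (M ++ node nil nil B) C) := by
  refine ⟨by simp; omega, fun a => ⟨insert (a, a + A.size + 1 + M.size + 1 + B.size) (A.tree a ∪
    M.tree (a + A.size + 1) ∪ B.tree (a + A.size + 1 + M.size + 1) ∪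
    C.tree (a + A.size + 1 + M.size + 1 + B.size)), (a + A.size, a + A.size + 1),
    (a + A.size + 1 + M.size, a + A.size + 1 + M.size + 1), ?_, ?_⟩⟩
  · have h1 : a + (A ++ node nil nil M).size + 1 = a + A.size + 1 + M.size + 1 := by
      simp; omega
    rw [tree_node, tree_append, tree_node, h1, Finset.insert_comm (a + A.size, a + A.size + 1)]
    simp [Finset.union_assoc]
  · have h1 : a + A.size + 1 + (M ++ node nil nil B).size = a + A.size + 1 + M.size + 1 + B.size := by
      simp; omega
    rw [tree_node, tree_append, tree_node, h1, Finset.insert_comm (a + A.size + 1 + M.size, _)]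
    simp [Finset.union_assoc]

end Flip

/-! ### Flips of words -/

/-- `w` is the word of a ternary tree. -/
def IsWord (w : List DyckStep) : Prop := ∃ T : Tern, T.word = w

/-- `w` and `w'` are the words of trees that differ in at most one edge. -/
def FlipWord (w w' : List DyckStep) : Prop := ∃ S T : Tern, S.word = w ∧ T.word = w' ∧ Flip S T

lemma Flip.flipWord {S T : Tern} (h : Flip S T) {w w' : List DyckStep} (hS : S.word = w)
    (hT : T.word = w') : FlipWord w w' := ⟨S, T, hS, hT, h⟩

/-- Words and flips survive between `p` and `q`. -/
structure IsContext (p q : List DyckStep) : Prop where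
  isWord : ∀ {w}, IsWord w → IsWord (p ++ w ++ q)
  flipWord : ∀ {w w'}, FlipWord w w' → FlipWord (p ++ w ++ q) (p ++ w' ++ q)

lemma isContext_left (B C : Tern) : IsContext [U] (U :: B.word ++ D :: C.word) where
  isWord := by
    rintro _ ⟨T, rfl⟩
    exact ⟨node T B C, by simp⟩
  flipWord := by
    rintro _ _ ⟨S, T, rfl, rfl, h⟩
    exact (h.node_left B C).flipWord (by simp) (by simp)

lemma isContext_mid (A C : Tern) : IsContext (U :: A.word ++ [U]) (D :: C.word) where
  isWord := by
    rintro _ ⟨T, rfl⟩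
    exact ⟨node A T C, by simp⟩
  flipWord := by
    rintro _ _ ⟨S, T, rfl, rfl, h⟩
    exact (h.node_mid A C).flipWord (by simp) (by simp)

lemma isContext_right (A B : Tern) : IsContext (U :: A.word ++ U :: B.word ++ [D]) [] where
  isWord := by
    rintro _ ⟨T, rfl⟩
    exact ⟨node A B T, by simp⟩
  flipWord := by
    rintro _ _ ⟨S, T, rfl, rfl, h⟩
    exact (h.node_right A B).flipWord (by simp) (by simp)

lemma append_eq_append_cons {α : Type*} {u v p q : List α} {c : α} (h : u ++ v = p ++ c :: q) :
    (∃ q', u = p ++ c :: q' ∧ q = q' ++ v) ∨ (∃ p', p = u ++ p' ∧ v = p' ++ c :: q) := by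
  rcases List.append_eq_append_iff.1 h with ⟨r, h1, h2⟩ | ⟨r, h1, h2⟩
  · exact Or.inr ⟨r, h1, h2⟩
  · rcases r with _ | ⟨d, r⟩
    · exact Or.inr ⟨[], by simpa using h1.symm, by simpa using h2.symm⟩
    · simp only [List.cons_append, List.cons.injEq] at h2
      obtain ⟨rfl, h2⟩ := h2
      exact Or.inl ⟨r, h1, h2⟩

lemma cons_eq_append_cons {α : Type*} {v p q : List α} {c d : α} (h : d :: v = p ++ c :: q) :
    (p = [] ∧ c = d ∧ q = v) ∨ (∃ p', p = d :: p' ∧ v = p' ++ c :: q) := by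
  rcases p with _ | ⟨e, p⟩
  · simp only [List.nil_append, List.cons.injEq] at h
    exact Or.inl ⟨rfl, h.1.symm, h.2.symm⟩
  · simp only [List.cons_append, List.cons.injEq] at h
    exact Or.inr ⟨p, by rw [h.1], h.2⟩

/-- A factor `U U D` moves past any letter of a 2-Dyck path by a flip. -/
lemma flipWord_slide (T : Tern) {p q : List DyckStep} {c : DyckStep} (h : T.word = p ++ c :: q) :
    FlipWord (p ++ [U, U, D] ++ c :: q) (p ++ [c, U, U, D] ++ q) := by
  induction T generalizing p q with
  | nil => simp at h
  | node A B C hA hB hC =>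
    rw [word_node, List.append_assoc, List.cons_append, List.cons_append] at h
    rcases cons_eq_append_cons h with ⟨rfl, rfl, rfl⟩ | ⟨p, rfl, h₁⟩
    -- The three letters belonging to the root block each have their own flip: `pivot_right` for the
    -- opening up-step, `gap_move` for the second up-step, `pivot_left` for the down-step. Any other
    -- letter lies in a slot.
    · exact (Flip.pivot_right (node nil nil nil) A B C).symm.flipWord (by simp) (by simp)
    rcases append_eq_append_cons h₁ with ⟨q, h₂, rfl⟩ | ⟨p, rfl, h₂⟩
    · simpa using (isContext_left B C).flipWord (hA h₂)
    rcases cons_eq_append_cons h₂ with ⟨rfl, rfl, rfl⟩ | ⟨p, rfl, h₃⟩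
    · exact (Flip.gap_move A nil B C).flipWord (by simp) (by simp)
    rcases append_eq_append_cons h₃ with ⟨q, h₄, rfl⟩ | ⟨p, rfl, h₄⟩
    · simpa using (isContext_mid A C).flipWord (hB h₄)
    rcases cons_eq_append_cons h₄ with ⟨rfl, rfl, rfl⟩ | ⟨p, rfl, h₅⟩
    · exact (Flip.pivot_left A B (node nil nil nil) C).flipWord (by simp) (by simp)
    · simpa using (isContext_right A B).flipWord (hC h₅)

/-! ### Adjacent moves as short sequences of flips and a slide -/

/-- The adjacent move at `P U L U A [U D] Q` by way of a slide of `U U D` past `A`, for a block in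
the first slot of its parent. -/
structure RouteFst (P L A Q : List DyckStep) : Prop where
  isWord : IsWord (P ++ U :: L ++ A ++ Q)
  enter : FlipWord (P ++ U :: L ++ U :: A ++ U :: D :: Q) (P ++ U :: L ++ A ++ [U, U, D] ++ Q)
  leave : FlipWord (P ++ U :: L ++ [U, U, D] ++ A ++ Q) (P ++ U :: U :: L ++ U :: A ++ D :: Q)
  finish : FlipWord (P ++ U :: U :: L ++ U :: A ++ D :: Q) (P ++ U :: L ++ U :: A ++ D :: U :: Q)

/-- The adjacent move at `P U L U A [U D] Q` by way of a slide of `U U D` past `L`, for a block in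
the second slot of its parent. -/
structure RouteSnd (P L A Q : List DyckStep) : Prop where
  isWord : IsWord (P ++ L ++ A ++ U :: Q)
  start : FlipWord (P ++ U :: L ++ U :: A ++ U :: D :: Q) (P ++ U :: L ++ A ++ [U, U, D] ++ Q)
  enter : FlipWord (P ++ U :: L ++ A ++ [U, U, D] ++ Q) (P ++ [U, U, D] ++ L ++ A ++ U :: Q)
  leave : FlipWord (P ++ L ++ [U, U, D] ++ A ++ U :: Q) (P ++ U :: L ++ U :: A ++ D :: U :: Q)
  parse : ∃ (L' A' R : Tern) (S : List DyckStep),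
    L = L'.word ∧ A = A'.word ∧ Q = R.word ++ D :: S

lemma RouteFst.context {P L A Q p q : List DyckStep} (h : RouteFst P L A Q) (c : IsContext p q) :
    RouteFst (p ++ P) L A (Q ++ q) where
  isWord := by simpa using c.isWord h.isWord
  enter := by simpa using c.flipWord h.enter
  leave := by simpa using c.flipWord h.leave
  finish := by simpa using c.flipWord h.finish

lemma RouteSnd.context {P L A Q p q : List DyckStep} (h : RouteSnd P L A Q) (c : IsContext p q) :
    RouteSnd (p ++ P) L A (Q ++ q) where
  isWord := by simpa using c.isWord h.isWord
  start := by simpa using c.flipWord h.start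
  enter := by simpa using c.flipWord h.enter
  leave := by simpa using c.flipWord h.leave
  parse := by
    obtain ⟨L', A', R, S, h1, h2, h3⟩ := h.parse
    exact ⟨L', A', R, S ++ q, h1, h2, by simp [h3]⟩

/-- Before the unchanged suffix R U B D C the route reads U L U A U D → U L A UUD ⇝ U L UUD A → U U
L U A D → U L U A D U, where ⇝ is the slide. -/
lemma routeFst_base (L A R B C : Tern) :
    RouteFst [] L.word A.word (R.word ++ U :: B.word ++ D :: C.word) where
  isWord := ⟨node (L ++ A ++ R) B C, by simp⟩
  enter := (((Flip.pivot_gap A nil R).append_left L).node_left B C).flipWord (by simp) (by simp)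
  leave := (((Flip.pivot_gap L A R).symm).node_left B C).flipWord (by simp) (by simp)
  finish := (Flip.pivot_right (node L A nil) R B C).flipWord (by simp) (by simp)

/-- Between the unchanged U A₀ and R D C the route reads U L U A U D → U L A UUD → UUD L A U ⇝ L UUD
A U → U L U A D U. The slide passes L, not A. -/
lemma routeSnd_base (A₀ L A R C : Tern) :
    RouteSnd (U :: A₀.word) L.word A.word (R.word ++ D :: C.word) where
  isWord := ⟨node (A₀ ++ L ++ A) R C, by simp⟩
  start := (((Flip.pivot_gap A nil R).append_left L).node_mid A₀ C).flipWord (by simp) (by simp)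
  enter := (Flip.gap_move A₀ (L ++ A) R C).symm.flipWord (by simp) (by simp)
  leave := (((Flip.pivot_gap L A nil).symm.append_left A₀).node_left R C).flipWord
    (by simp) (by simp)
  parse := ⟨L, A, R, C.word, rfl, rfl, rfl⟩

lemma word_ne_append_U (T : Tern) (p : List DyckStep) : T.word ≠ p ++ [U] := by
  intro h
  have h1 := height_prefix_nonneg h
  have h2 := congrArg height h
  simp at h2
  omega

/-- A factor `U D` of a 2-Dyck path closes a top-level block or has a route for its swap. -/
lemma exists_route (T : Tern) {p q : List DyckStep} (h : T.word = p ++ U :: D :: q) :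
    (∃ L A R : Tern, p = L.word ++ U :: A.word ∧ q = R.word) ∨
    ∃ P L A Q, p = P ++ U :: L ++ U :: A ∧ q = Q ∧ (RouteFst P L A Q ∨ RouteSnd P L A Q) := by
  have lift : ∀ {p q r s : List DyckStep}, IsContext r s →
      (∃ P L A Q, p = P ++ U :: L ++ U :: A ∧ q = Q ∧ (RouteFst P L A Q ∨ RouteSnd P L A Q)) →
      ∃ P L A Q, r ++ p = P ++ U :: L ++ U :: A ∧ q ++ s = Q ∧
        (RouteFst P L A Q ∨ RouteSnd P L A Q) := by
    rintro p q r s c ⟨P, L, A, Q, rfl, rfl, h | h⟩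
    · exact ⟨r ++ P, L, A, q ++ s, by simp, rfl, Or.inl (h.context c)⟩
    · exact ⟨r ++ P, L, A, q ++ s, by simp, rfl, Or.inr (h.context c)⟩
  -- A word never ends in an up-step, so a factor UD cannot straddle its right end.
  have split : ∀ {T : Tern} {v p q : List DyckStep}, T.word ++ v = p ++ U :: D :: q →
      (∃ q', T.word = p ++ U :: D :: q' ∧ q = q' ++ v) ∨
      (∃ p', p = T.word ++ p' ∧ v = p' ++ U :: D :: q) := by
    intro T v p q h
    rcases append_eq_append_cons h with ⟨q', h, h'⟩ | h
    · rcases q' with _ | ⟨d, q'⟩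
      · exact absurd h (word_ne_append_U T p)
      · simp only [List.cons_append, List.cons.injEq] at h'
        obtain ⟨rfl, h'⟩ := h'
        exact Or.inl ⟨q', h, h'⟩
    · exact Or.inr h
  induction T generalizing p q with
  | nil => simp at h
  | node A B C hA hB hC =>
    rw [word_node, List.append_assoc, List.cons_append, List.cons_append] at h
    rcases cons_eq_append_cons h with ⟨rfl, -, h₁⟩ | ⟨p, rfl, h₁⟩
    · exfalso
      cases A with
      | nil => simp at h₁
      | node A₁ A₂ A₃ => simp at h₁
    rcases split h₁ with ⟨q, h₂, rfl⟩ | ⟨p, rfl, h₂⟩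
    · right
      rcases hA h₂ with ⟨L, A', R, rfl, rfl⟩ | h₃
      -- A top-level block of the first slot has the current node as its parent.
      · exact ⟨[], L.word, A'.word, _, by simp, rfl, Or.inl (by simpa using routeFst_base L A' R B C)⟩
      · simpa using lift (isContext_left B C) h₃
    rcases cons_eq_append_cons h₂ with ⟨rfl, -, h₃⟩ | ⟨p, rfl, h₃⟩
    -- Here the up-step is the second one of the root block, so B is empty and the block is
    -- top-level.
    · left
      cases B with
      | nil =>
        simp at h₃
        exact ⟨nil, A, C, by simp, h₃⟩
      | node B₁ B₂ B₃ => simp at h₃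
    rcases split h₃ with ⟨q, h₄, rfl⟩ | ⟨p, rfl, h₄⟩
    · right
      rcases hB h₄ with ⟨L, A', R, rfl, rfl⟩ | h₅
      · exact ⟨U :: A.word, L.word, A'.word, _, by simp, rfl, Or.inr (routeSnd_base A L A' R C)⟩
      · simpa using lift (isContext_mid A C) h₅
    rcases cons_eq_append_cons h₄ with ⟨rfl, h₅, -⟩ | ⟨p, rfl, h₅⟩
    · simp at h₅
    rcases hC h₅ with ⟨L, A', R, rfl, rfl⟩ | h₆
    · exact Or.inl ⟨node A B L, A', R, by simp, rfl⟩
    · right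
      simpa using lift (isContext_right A B) h₆

/-- Every valid swap of a factor `U D` has a route. -/
lemma exists_route_of_swap {p q : List DyckStep} (h : IsWord (p ++ U :: D :: q))
    (h' : IsWord (p ++ D :: U :: q)) :
    ∃ P L A, p = P ++ U :: L ++ U :: A ∧ (RouteFst P L A q ∨ RouteSnd P L A q) := by
  obtain ⟨T, hT⟩ := h
  rcases exists_route T hT with ⟨L, A, R, rfl, -⟩ | ⟨P, L, A, Q, h1, rfl, h2⟩
  · exfalso
    obtain ⟨T', hT'⟩ := h'
    -- Swapping in a top-level block would bring the path down to height -1.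
    have := height_prefix_nonneg (T := T') (P := L.word ++ U :: A.word ++ [D]) (Q := U :: q)
      (by rw [hT']; simp)
    simp at this
  · exact ⟨P, L, A, h1, h2⟩

/-! ### Energies -/

/-- The contribution of the moves out of `S` to the Dirichlet form of the flip chain. -/
def flipEnergy {n : ℕ} (h : NCST n → ℝ) (S : NCST n) : ℝ :=
  ∑ Z, (h S - h Z) ^ 2 * PFM n S Z

lemma PFM_nonneg {n : ℕ} (S T : NCST n) : 0 ≤ PFM n S T := by
  unfold PFM
  split_ifs
  · exact Finset.sum_nonneg fun _ _ => by positivity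
  · positivity
  · exact le_rfl

lemma flipEnergy_nonneg {n : ℕ} (h : NCST n → ℝ) (S : NCST n) : 0 ≤ flipEnergy h S :=
  Finset.sum_nonneg fun _ _ => mul_nonneg (sq_nonneg _) (PFM_nonneg _ _)

lemma card_ncst {n : ℕ} (S : NCST n) : S.1.card = n := by
  have := (isNCST_iff.1 S.2).card
  omega

/-- The trees that contain `F`. -/
def completions (n : ℕ) (F : Finset (ℕ × ℕ)) : Finset (NCST n) :=
  Finset.univ.filter fun Z => F ⊆ Z.1

lemma card_completions {n : ℕ} {F : Finset (ℕ × ℕ)} (hF : F.card + 1 = n) :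
    (completions n F).card = numCompletions n F := by
  symm
  refine Finset.card_bij (fun k hk => ⟨insert k F, (Finset.mem_filter.1 hk).2.2⟩) ?_ ?_ ?_
  · intro k hk
    exact Finset.mem_filter.2 ⟨Finset.mem_univ _, Finset.subset_insert _ _⟩
  · intro k hk l hl h
    have h1 : insert k F = insert l F := Subtype.mk.inj h
    exact (Finset.insert_inj (Finset.mem_filter.1 hk).2.1).1 h1
  · intro Z hZ
    have h1 : F ⊆ Z.1 := (Finset.mem_filter.1 hZ).2
    obtain ⟨k, hk, hkZ⟩ := Finset.exists_eq_insert_iff.2 ⟨h1, by rw [hF, card_ncst]⟩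
    have h2 := (isNCST_iff.1 Z.2).range k (by rw [← hkZ]; exact Finset.mem_insert_self _ _)
    refine ⟨k, Finset.mem_filter.2 ⟨?_, hk, by rw [hkZ]; exact Z.2⟩, Subtype.ext hkZ⟩
    simp only [Finset.mem_product, Finset.mem_range]
    omega

/-- Any completion other than `S` meets `S` exactly in `F`, so all of them are reached from `S` with
the same probability 1/(nδ). -/
lemma sum_completions_le {n : ℕ} {F : Finset (ℕ × ℕ)} (hF : F.card + 1 = n) (h : NCST n → ℝ)
    {S : NCST n} (hS : F ⊆ S.1) :
    ∑ Z ∈ completions n F, (h S - h Z) ^ 2 ≤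
      n * (completions n F).card * flipEnergy h S := by
  have hpos : (0 : ℝ) < n * (completions n F).card := by
    have h1 : 0 < n := by omega
    have h2 : 0 < (completions n F).card :=
      Finset.card_pos.2 ⟨S, Finset.mem_filter.2 ⟨Finset.mem_univ _, hS⟩⟩
    positivity
  unfold flipEnergy
  rw [Finset.mul_sum]
  refine (Finset.sum_le_sum fun Z hZ => ?_).trans
    (Finset.sum_le_sum_of_subset_of_nonneg (Finset.subset_univ (completions n F)) fun Z _ _ =>
      mul_nonneg hpos.le (mul_nonneg (sq_nonneg _) (PFM_nonneg _ _)))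
  have hZ : F ⊆ Z.1 := (Finset.mem_filter.1 hZ).2
  by_cases hne : S = Z
  · simp [hne]
  have hint : S.1 ∩ Z.1 = F := by
    symm
    refine Finset.eq_of_subset_of_card_le (Finset.subset_inter hS hZ) ?_
    by_contra! hlt
    have h1 : S.1 ∩ Z.1 = S.1 :=
      Finset.eq_of_subset_of_card_le Finset.inter_subset_left (by rw [card_ncst]; omega)
    have h2 : S.1 ∩ Z.1 = Z.1 :=
      Finset.eq_of_subset_of_card_le Finset.inter_subset_right (by rw [card_ncst]; omega)
    exact hne (Subtype.ext (h1.symm.trans h2))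
  have hP : PFM n S Z = 1 / ((n : ℝ) * (completions n F).card) := by
    rw [PFM, if_neg hne, hint, if_pos hF, card_completions hF]
  rw [hP]
  rw [mul_left_comm, mul_one_div_cancel hpos.ne', mul_one]

/-- A single flip costs at most the local energies at its ends, however many completions the
common part has. -/
lemma sq_sub_le_of_flip {n : ℕ} (h : NCST n → ℝ) {S T : NCST n} {F : Finset (ℕ × ℕ)} {e e' : ℕ × ℕ}
    (hS : S.1 = insert e F) (hT : T.1 = insert e' F) :
    (h S - h T) ^ 2 ≤ 2 * n * flipEnergy h S + 2 * n * flipEnergy h T := by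
  have hES := flipEnergy_nonneg h S
  have hET := flipEnergy_nonneg h T
  by_cases hST : S = T
  · have := mul_nonneg (by positivity : (0 : ℝ) ≤ 2 * n) hET
    rw [hST, sub_self, zero_pow two_ne_zero]
    linarith
  have hSF : F ⊆ S.1 := by rw [hS]; exact Finset.subset_insert _ _
  have hTF : F ⊆ T.1 := by rw [hT]; exact Finset.subset_insert _ _
  have he : e ∉ F := by
    intro he
    rw [Finset.insert_eq_of_mem he] at hS
    rw [← hS] at hTF
    exact hST (Subtype.ext (Finset.eq_of_subset_of_card_le hTF (by rw [card_ncst, card_ncst])))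
  have hF : F.card + 1 = n := by
    rw [← card_ncst S, hS, Finset.card_insert_of_notMem he]
  have hpos : (0 : ℝ) < (completions n F).card := by
    exact_mod_cast Finset.card_pos.2 ⟨S, Finset.mem_filter.2 ⟨Finset.mem_univ _, hSF⟩⟩
  have h1 := sum_completions_le hF h hSF
  have h2 := sum_completions_le hF h hTF
  -- Each of the δ completions serves as an intermediate point between `S` and `T`; the factor δ
  -- then cancels against the transition probabilities.
  have h3 : ((completions n F).card : ℝ) * (h S - h T) ^ 2 ≤
      2 * ∑ Z ∈ completions n F, (h S - h Z) ^ 2 + 2 * ∑ Z ∈ completions n F, (h T - h Z) ^ 2 := by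
    rw [Finset.mul_sum, Finset.mul_sum, ← Finset.sum_add_distrib, ← nsmul_eq_mul,
      ← Finset.sum_const]
    exact Finset.sum_le_sum fun Z _ => by nlinarith [sq_nonneg (h S - h Z + (h T - h Z))]
  have h4 : ((completions n F).card : ℝ) * (h S - h T) ^ 2 ≤ (completions n F).card *
      (2 * n * flipEnergy h S + 2 * n * flipEnergy h T) := by
    linarith
  exact le_of_mul_le_mul_left h4 hpos

/-- Extension of a function on 2-Dyck paths to all words. -/
def extend {n : ℕ} (φ : TwoDyck n → ℝ) (w : List DyckStep) : ℝ :=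
  if h : w.length = 3 * n ∧ IsTwoDyck w then φ ⟨w, h⟩ else 0

@[simp] lemma extend_coe {n : ℕ} (φ : TwoDyck n → ℝ) (X : TwoDyck n) : extend φ X.1 = φ X := by
  rw [extend, dif_pos X.2]

lemma extend_word {n : ℕ} (φ : TwoDyck n → ℝ) {T : Tern} (hT : T.size = n) :
    extend φ T.word = φ (toPath T hT) := extend_coe φ (toPath T hT)

lemma extend_nonneg {n : ℕ} {φ : TwoDyck n → ℝ} (hφ : ∀ X, 0 ≤ φ X) (w : List DyckStep) :
    0 ≤ extend φ w := by
  unfold extend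
  split_ifs
  · exact hφ _
  · exact le_rfl

lemma treeEquiv_toPath {n : ℕ} {T : Tern} (hT : T.size = n) :
    (treeEquiv n (toPath T hT)).1 = T.tree 0 := by
  have : ternOf (toPath T hT) = T := word_injective (by simp [toPath])
  simp [treeEquiv, toTree, this]

/-- The values `v` on words of length `3 n` change by at most the energies `ε` along flips. -/
structure FlipBound (n : ℕ) (v ε : List DyckStep → ℝ) : Prop where
  nonneg : ∀ w, 0 ≤ ε w
  le : ∀ {w w'}, FlipWord w w' → w.length = 3 * n → (v w - v w') ^ 2 ≤ ε w + ε w'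

/-- The factor `2 * n` is the one of `sq_sub_le_of_flip`. -/
lemma flipBound_extend {n : ℕ} (f : TwoDyck n → ℝ) : FlipBound n (extend f)
    (extend fun X => 2 * n * flipEnergy (fun T => f ((treeEquiv n).symm T)) (treeEquiv n X)) where
  nonneg := extend_nonneg fun X => mul_nonneg (by positivity) (flipEnergy_nonneg _ _)
  le := by
    rintro _ _ ⟨S, T, rfl, rfl, h⟩ hl
    rw [length_word] at hl
    have hS : S.size = n := by omega
    have hT : T.size = n := h.1 ▸ hS
    obtain ⟨F, e, e', h1, h2⟩ := h.2 0
    simp only [extend_word _ hS, extend_word _ hT]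
    have := sq_sub_le_of_flip (fun T => f ((treeEquiv n).symm T))
      (S := treeEquiv n (toPath S hS)) (T := treeEquiv n (toPath T hT))
      (by rw [treeEquiv_toPath, h1]) (by rw [treeEquiv_toPath, h2])
    simpa using this

/-! ### Slides -/

/-- Insertion of `U U D` at position `i`. -/
def insertPeak (W : List DyckStep) (i : ℕ) : List DyckStep := W.take i ++ [U, U, D] ++ W.drop i

lemma insertPeak_append (p q : List DyckStep) :
    insertPeak (p ++ q) p.length = p ++ [U, U, D] ++ q := by
  simp [insertPeak]

lemma flipWord_insertPeak {W : List DyckStep} (hW : IsWord W) {i : ℕ} (hi : i < W.length) :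
    FlipWord (insertPeak W i) (insertPeak W (i + 1)) := by
  obtain ⟨T, rfl⟩ := hW
  have h : T.word = T.word.take i ++ T.word[i] :: T.word.drop (i + 1) := by
    rw [← List.drop_eq_getElem_cons hi, List.take_append_drop]
  have h1 := flipWord_slide T h
  rw [← List.drop_eq_getElem_cons hi] at h1
  unfold insertPeak
  convert h1 using 1
  rw [List.take_succ_eq_append_getElem hi]
  simp only [List.append_assoc, List.cons_append, List.nil_append]

/-- The total energy along the slide of `U U D` through `W`. -/
def slideEnergy (ε : List DyckStep → ℝ) (W : List DyckStep) : ℝ :=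
  ∑ i ∈ Finset.range (W.length + 1), ε (insertPeak W i)

/-- Telescoping and Cauchy-Schwarz. -/
lemma sq_sub_le_sum_range (g : ℕ → ℝ) {i j N : ℕ} (hij : i ≤ j) (hj : j ≤ N) :
    (g j - g i) ^ 2 ≤ N * ∑ k ∈ Finset.range N, (g k - g (k + 1)) ^ 2 := by
  have h1 : g j - g i = ∑ k ∈ Finset.Ico i j, (g (k + 1) - g k) := (Finset.sum_Ico_sub g hij).symm
  rw [h1]
  refine sq_sum_le_card_mul_sum_sq.trans ?_
  have h2 : ∑ k ∈ Finset.Ico i j, (g (k + 1) - g k) ^ 2 ≤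
      ∑ k ∈ Finset.range N, (g k - g (k + 1)) ^ 2 := by
    refine (Finset.sum_le_sum fun k _ => le_of_eq (by ring)).trans
      (Finset.sum_le_sum_of_subset_of_nonneg (fun k hk => ?_) fun _ _ _ => sq_nonneg _)
    rw [Finset.mem_Ico] at hk
    rw [Finset.mem_range]
    omega
  have h3 : ((Finset.Ico i j).card : ℝ) ≤ N := by
    rw [Nat.card_Ico]
    exact_mod_cast (by omega : j - i ≤ N)
  exact mul_le_mul h3 h2 (Finset.sum_nonneg fun _ _ => sq_nonneg _) (Nat.cast_nonneg _)

section

variable {m : ℕ} {v ε : List DyckStep → ℝ}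

/-- At most `3 * m` flips, with each intermediate path an end of at most two of them: 3m · 2 = 6m.
-/
lemma FlipBound.slide (hb : FlipBound (m + 1) v ε) {W : List DyckStep} (hW : IsWord W)
    (hl : W.length = 3 * m) {i j : ℕ} (hij : i ≤ j) (hj : j ≤ W.length) :
    (v (insertPeak W j) - v (insertPeak W i)) ^ 2 ≤ 6 * m * slideEnergy ε W := by
  refine (sq_sub_le_sum_range (fun k => v (insertPeak W k)) hij hj).trans ?_
  have h1 : ∑ k ∈ Finset.range W.length, (v (insertPeak W k) - v (insertPeak W (k + 1))) ^ 2 ≤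
      ∑ k ∈ Finset.range W.length, ε (insertPeak W k) +
      ∑ k ∈ Finset.range W.length, ε (insertPeak W (k + 1)) := by
    rw [← Finset.sum_add_distrib]
    refine Finset.sum_le_sum fun k hk => ?_
    rw [Finset.mem_range] at hk
    refine hb.le (flipWord_insertPeak hW hk) ?_
    simp [insertPeak]
    omega
  have h2 : ∑ k ∈ Finset.range W.length, ε (insertPeak W k) ≤ slideEnergy ε W := by
    rw [slideEnergy, Finset.sum_range_succ]
    linarith [hb.nonneg (insertPeak W W.length)]
  have h3 : ∑ k ∈ Finset.range W.length, ε (insertPeak W (k + 1)) ≤ slideEnergy ε W := by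
    rw [slideEnergy, Finset.sum_range_succ']
    linarith [hb.nonneg (insertPeak W 0)]
  rw [hl] at *
  push_cast
  have : (0 : ℝ) ≤ m := Nat.cast_nonneg m
  nlinarith

lemma FlipBound.le_slideEnergy {n : ℕ} (hb : FlipBound n v ε) {W : List DyckStep} {i : ℕ}
    (hi : i ≤ W.length) : ε (insertPeak W i) ≤ slideEnergy ε W :=
  Finset.single_le_sum (f := fun i => ε (insertPeak W i)) (fun _ _ => hb.nonneg _)
    (Finset.mem_range.2 (by omega))

lemma sq_sub_le_four (a b c d e : ℝ) :
    (a - e) ^ 2 ≤ 4 * ((a - b) ^ 2 + (b - c) ^ 2 + (c - d) ^ 2 + (d - e) ^ 2) := by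
  nlinarith [sq_nonneg ((a - b) - (b - c)), sq_nonneg ((a - b) - (c - d)),
    sq_nonneg ((a - b) - (d - e)), sq_nonneg ((b - c) - (c - d)), sq_nonneg ((b - c) - (d - e)),
    sq_nonneg ((c - d) - (d - e))]

/-- Four increments cost a factor 4. The intermediate tree outside the slide ends two flips, whence
8; the slide contributes 4 · 6m, and its two end terms another 4 · 2, in all at most 24(m + 1). -/
lemma FlipBound.routeFst (hb : FlipBound (m + 1) v ε) {P L A Q : List DyckStep}
    (h : RouteFst P L A Q) (hl : (P ++ U :: L ++ A ++ Q).length = 3 * m) :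
    (v (P ++ U :: L ++ U :: A ++ U :: D :: Q) - v (P ++ U :: L ++ U :: A ++ D :: U :: Q)) ^ 2 ≤
      8 * (ε (P ++ U :: L ++ U :: A ++ U :: D :: Q) + ε (P ++ U :: L ++ U :: A ++ D :: U :: Q) +
        ε (P ++ U :: U :: L ++ U :: A ++ D :: Q)) +
      24 * (m + 1) * slideEnergy ε (P ++ U :: L ++ A ++ Q) := by
  have e1 : P ++ U :: L ++ A ++ [U, U, D] ++ Q =
      insertPeak (P ++ U :: L ++ A ++ Q) (P ++ U :: L ++ A).length := by
    rw [insertPeak_append]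
  have e2 : P ++ U :: L ++ [U, U, D] ++ A ++ Q =
      insertPeak (P ++ U :: L ++ A ++ Q) (P ++ U :: L).length := by
    rw [List.append_assoc (P ++ U :: L) A Q, insertPeak_append]
    simp
  have b1 := hb.le h.enter (by simp at hl ⊢; omega)
  have b2 := hb.le h.leave (by simp at hl ⊢; omega)
  have b3 := hb.le h.finish (by simp at hl ⊢; omega)
  have b4 := hb.slide h.isWord hl (i := (P ++ U :: L).length) (j := (P ++ U :: L ++ A).length)
    (by simp) (by simp)
  have b5 := hb.le_slideEnergy (W := P ++ U :: L ++ A ++ Q) (i := (P ++ U :: L).length) (by simp)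
  have b6 := hb.le_slideEnergy (W := P ++ U :: L ++ A ++ Q) (i := (P ++ U :: L ++ A).length)
    (by simp)
  rw [← e1, ← e2] at b4
  rw [← e2] at b5
  rw [← e1] at b6
  have b7 := hb.nonneg (P ++ U :: L ++ U :: A ++ U :: D :: Q)
  have b8 := hb.nonneg (P ++ U :: L ++ U :: A ++ D :: U :: Q)
  have b9 := (hb.nonneg _).trans b6
  refine (sq_sub_le_four _ (v (P ++ U :: L ++ A ++ [U, U, D] ++ Q))
    (v (P ++ U :: L ++ [U, U, D] ++ A ++ Q)) (v (P ++ U :: U :: L ++ U :: A ++ D :: Q)) _).trans ?_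
  nlinarith

lemma FlipBound.routeSnd (hb : FlipBound (m + 1) v ε) {P L A Q : List DyckStep}
    (h : RouteSnd P L A Q) (hl : (P ++ L ++ A ++ U :: Q).length = 3 * m) :
    (v (P ++ U :: L ++ U :: A ++ U :: D :: Q) - v (P ++ U :: L ++ U :: A ++ D :: U :: Q)) ^ 2 ≤
      8 * (ε (P ++ U :: L ++ U :: A ++ U :: D :: Q) + ε (P ++ U :: L ++ U :: A ++ D :: U :: Q) +
        ε (P ++ U :: L ++ A ++ [U, U, D] ++ Q)) +
      24 * (m + 1) * slideEnergy ε (P ++ L ++ A ++ U :: Q) := by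
  have e1 : P ++ [U, U, D] ++ L ++ A ++ U :: Q =
      insertPeak (P ++ L ++ A ++ U :: Q) P.length := by
    rw [show P ++ L ++ A ++ U :: Q = P ++ (L ++ A ++ U :: Q) by simp, insertPeak_append]
    simp
  have e2 : P ++ L ++ [U, U, D] ++ A ++ U :: Q =
      insertPeak (P ++ L ++ A ++ U :: Q) (P ++ L).length := by
    rw [show P ++ L ++ A ++ U :: Q = P ++ L ++ (A ++ U :: Q) by simp, insertPeak_append]
    simp
  have b1 := hb.le h.start (by simp at hl ⊢; omega)
  have b2 := hb.le h.enter (by simp at hl ⊢; omega)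
  have b3 := hb.le h.leave (by simp at hl ⊢; omega)
  have b4 := hb.slide h.isWord hl (i := P.length) (j := (P ++ L).length) (by simp) (by simp)
  have b5 := hb.le_slideEnergy (W := P ++ L ++ A ++ U :: Q) (i := (P ++ L).length) (by simp)
  have b6 := hb.le_slideEnergy (W := P ++ L ++ A ++ U :: Q) (i := P.length) (by simp)
  rw [← e1, ← e2, sub_sq_comm] at b4
  rw [← e2] at b5
  rw [← e1] at b6
  have b7 := hb.nonneg (P ++ U :: L ++ U :: A ++ U :: D :: Q)
  have b8 := hb.nonneg (P ++ U :: L ++ U :: A ++ D :: U :: Q)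
  have b9 := (hb.nonneg _).trans b6
  refine (sq_sub_le_four _ (v (P ++ U :: L ++ A ++ [U, U, D] ++ Q))
    (v (P ++ [U, U, D] ++ L ++ A ++ U :: Q)) (v (P ++ L ++ [U, U, D] ++ A ++ U :: Q)) _).trans ?_
  nlinarith

end

/-! ### Counting routes -/

/-- The code `k` separates the points of each fibre of `z`, so a fibre has at most as many elements
as `κ`. -/
lemma sum_comp_le_of_code {ι Ω κ : Type*} [Fintype ι] [Fintype Ω] [Fintype κ] (z : ι → Ω)
    (k : ι → κ) (hinj : ∀ i j, z i = z j → k i = k j → i = j) (φ : Ω → ℝ) (hφ : ∀ x, 0 ≤ φ x) :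
    ∑ i, φ (z i) ≤ Fintype.card κ * ∑ x, φ x := by
  have h1 : ∑ i, φ (z i) = ∑ y ∈ Finset.univ.image fun i => (z i, k i), φ y.1 := by
    rw [Finset.sum_image]
    intro i _ j _ h
    exact hinj i j (Prod.mk.inj h).1 (Prod.mk.inj h).2
  have h2 : ∑ y : Ω × κ, φ y.1 = Fintype.card κ * ∑ x, φ x := by
    rw [Fintype.sum_prod_type]
    simp [Finset.mul_sum]
  rw [h1, ← h2]
  exact Finset.sum_le_sum_of_subset_of_nonneg (Finset.subset_univ _) fun y _ _ => hφ _

/-- `w'` results from `w` by replacing a factor `U D` with `D U`. -/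
def SwapUD (w w' : List DyckStep) : Prop := ∃ p q, w = p ++ U :: D :: q ∧ w' = p ++ D :: U :: q

lemma swapUD_or_of_adjSwap {w w' : List DyckStep} (h : AdjSwap w w') (hne : w ≠ w') :
    SwapUD w w' ∨ SwapUD w' w := by
  obtain ⟨u, v, a, b, rfl, rfl⟩ := h
  cases a <;> cases b
  · exact absurd rfl hne
  · exact Or.inl ⟨u, v, rfl, rfl⟩
  · exact Or.inr ⟨u, v, rfl, rfl⟩
  · exact absurd rfl hne

/-- The words met on the route of a swap: the intermediate tree `z` and the path `w` through which
the factor `U U D` slides. -/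
inductive RouteWords (P L A Q : List DyckStep) :
    Bool → (z : List DyckStep) → (w : List DyckStep) → Prop
  | fst : RouteWords P L A Q true (P ++ U :: U :: L ++ U :: A ++ D :: Q) (P ++ U :: L ++ A ++ Q)
  | snd (L' A' R : Tern) (S : List DyckStep) (hL : L = L'.word) (hA : A = A'.word)
      (hQ : Q = R.word ++ D :: S) :
      RouteWords P L A Q false (P ++ U :: L ++ A ++ [U, U, D] ++ Q) (P ++ L ++ A ++ U :: Q)

lemma exists_path_of_isWord {n : ℕ} {w : List DyckStep} (h : IsWord w) (hl : w.length = 3 * n) :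
    ∃ X : TwoDyck n, X.1 = w := ⟨⟨w, hl, isTwoDyck_iff_exists_word.2 h⟩, rfl⟩

lemma FlipWord.isWord_right {w w' : List DyckStep} (h : FlipWord w w') : IsWord w' := by
  obtain ⟨_, T, _, hT, _⟩ := h
  exact ⟨T, hT⟩

lemma FlipBound.exists_routeWords {m : ℕ} {v ε : List DyckStep → ℝ} (hb : FlipBound (m + 1) v ε)
    {X X' : TwoDyck (m + 1)} (h : SwapUD X.1 X'.1) :
    ∃ (P L A Q : List DyckStep) (b : Bool) (Z : TwoDyck (m + 1)) (W : TwoDyck m),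
      X.1 = P ++ U :: L ++ U :: A ++ U :: D :: Q ∧ X'.1 = P ++ U :: L ++ U :: A ++ D :: U :: Q ∧
      RouteWords P L A Q b Z.1 W.1 ∧
      (v X.1 - v X'.1) ^ 2 ≤
        8 * (ε X.1 + ε X'.1 + ε Z.1) + 24 * (m + 1) * slideEnergy ε W.1 := by
  obtain ⟨p, q, h1, h2⟩ := h
  obtain ⟨P, L, A, rfl, hr⟩ := exists_route_of_swap
    (h1 ▸ isTwoDyck_iff_exists_word.1 X.2.2) (h2 ▸ isTwoDyck_iff_exists_word.1 X'.2.2)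
  have hl := X.2.1
  rw [h1] at hl
  simp at hl
  rcases hr with hr | hr
  · have hlW : (P ++ U :: L ++ A ++ q).length = 3 * m := by simp; omega
    obtain ⟨W, hW⟩ := exists_path_of_isWord hr.isWord hlW
    obtain ⟨Z, hZ⟩ := exists_path_of_isWord (n := m + 1) hr.leave.isWord_right (by simp; omega)
    refine ⟨P, L, A, q, true, Z, W, h1, h2, ?_, ?_⟩
    · rw [hZ, hW]
      exact RouteWords.fst
    · rw [h1, h2, hZ, hW]
      exact hb.routeFst hr hlW
  · have hlW : (P ++ L ++ A ++ U :: q).length = 3 * m := by simp; omega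
    obtain ⟨W, hW⟩ := exists_path_of_isWord hr.isWord hlW
    obtain ⟨Z, hZ⟩ := exists_path_of_isWord (n := m + 1) hr.start.isWord_right (by simp; omega)
    refine ⟨P, L, A, q, false, Z, W, h1, h2, ?_, ?_⟩
    · rw [hZ, hW]
      obtain ⟨L', A', R, S, hL, hA, hQ⟩ := hr.parse
      exact RouteWords.snd L' A' R S hL hA hQ
    · rw [h1, h2, hZ, hW]
      exact hb.routeSnd hr hlW

lemma blocks_unique {α : Type*} {P L A Q P' L' A' Q' s t u : List α}
    (h : P ++ (s ++ (L ++ (t ++ (A ++ (u ++ Q))))) = P' ++ (s ++ (L' ++ (t ++ (A' ++ (u ++ Q'))))))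
    (hP : P.length = P'.length) (hL : L.length = L'.length) (hA : A.length = A'.length) :
    P = P' ∧ L = L' ∧ A = A' ∧ Q = Q' := by
  obtain ⟨h1, h⟩ := List.append_inj h hP
  obtain ⟨h2, h⟩ := List.append_inj (List.append_cancel_left h) hL
  obtain ⟨h3, h⟩ := List.append_inj (List.append_cancel_left h) hA
  exact ⟨h1, h2, h3, List.append_cancel_left h⟩

lemma RouteWords.blocks_unique {P L A Q P' L' A' Q' z w w' : List DyckStep} {b : Bool}
    (h : RouteWords P L A Q b z w) (h' : RouteWords P' L' A' Q' b z w')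
    (hP : P.length = P'.length) (hL : L.length = L'.length) (hA : A.length = A'.length) :
    P = P' ∧ L = L' ∧ A = A' ∧ Q = Q' := by
  obtain ⟨z', hz⟩ : ∃ z', z' = z := ⟨z, rfl⟩
  rw [← hz] at h'
  cases h with
  | fst =>
    cases h' with
    | fst =>
      exact FlipChain.blocks_unique (s := [U, U]) (t := [U]) (u := [D])
        (by simpa using hz.symm) hP hL hA
  | snd =>
    cases h' with
    | snd =>
      exact FlipChain.blocks_unique (s := [U]) (t := []) (u := [U, U, D])
        (by simpa using hz.symm) hP hL hA

/-- The two lengths that recover a swap from the path of its slide. -/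
def slideCode (P L A : List DyckStep) : Bool → ℕ × ℕ
  | true => (P.length + 1 + L.length, A.length)
  | false => (P.length, L.length)

/-- Two lengths suffice. In the first case the swap depends on P and L only through P U L. In the
second, P and L are cut off by length and A is then determined by the first passage below its
starting height. A third length would cost another factor n. The choices UD and DU of `r` give both
ends of the move. -/
lemma RouteWords.slide_unique {P L A Q P' L' A' Q' z z' w : List DyckStep} {b : Bool}
    (h : RouteWords P L A Q b z w) (h' : RouteWords P' L' A' Q' b z' w)
    (hc : slideCode P L A b = slideCode P' L' A' b) (r : List DyckStep) :
    P ++ U :: L ++ U :: A ++ r ++ Q = P' ++ U :: L' ++ U :: A' ++ r ++ Q' := by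
  obtain ⟨w', hw⟩ : ∃ w', w' = w := ⟨w, rfl⟩
  rw [← hw] at h'
  cases h with
  | fst =>
    cases h' with
    | fst =>
      simp only [slideCode, Prod.mk.injEq] at hc
      rw [List.append_assoc (P ++ U :: L), List.append_assoc (P' ++ U :: L')] at hw
      obtain ⟨h1, h2⟩ := List.append_inj hw (by simp; omega)
      obtain ⟨h3, h4⟩ := List.append_inj h2 (by omega)
      rw [h1, h3, h4]
  | snd L₁ A₁ R₁ S₁ hL hA hQ =>
    cases h' with
    | snd L₂ A₂ R₂ S₂ hL' hA' hQ' =>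
      simp only [slideCode, Prod.mk.injEq] at hc
      rw [List.append_assoc (P ++ L), List.append_assoc (P' ++ L'), List.append_assoc P,
        List.append_assoc P'] at hw
      obtain ⟨h1, h2⟩ := List.append_inj hw (by omega)
      obtain ⟨h3, h4⟩ := List.append_inj h2 (by omega)
      have h5 : A = A' := by
        have h6 := h4
        rw [hA, hA', hQ, hQ'] at h6
        rw [hA, hA', passage_unique (M := A₂) (M' := A₁) (R := R₂) (R' := R₁) (S := S₂) (S' := S₁)
          (by simpa using h6)]
      rw [h5] at h4
      have h7 : Q' = Q := by simpa using h4
      rw [h1, h3, h5, h7]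

/-- For a fixed position, inserting a peak is injective, so a path arises at most 3m + 1 times. -/
lemma sum_slideEnergy_le {m : ℕ} {ε : List DyckStep → ℝ} (hε : ∀ w, 0 ≤ ε w) :
    ∑ W : TwoDyck m, slideEnergy ε W.1 ≤ 3 * (m + 1) * ∑ X : TwoDyck (m + 1), ε X.1 := by
  have hX : ∀ (W : TwoDyck m) (i : Fin (3 * m + 1)),
      ∃ X : TwoDyck (m + 1), X.1 = insertPeak W.1 i := by
    intro W i
    have hl := W.2.1
    refine exists_path_of_isWord ?_ (by simp [insertPeak]; omega)
    have hw : IsWord W.1 := isTwoDyck_iff_exists_word.1 W.2.2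
    obtain ⟨i, hi⟩ := i
    rcases i with _ | i
    · obtain ⟨T, hT⟩ := hw
      exact ⟨node nil nil T, by simp [insertPeak, hT]⟩
    · exact (flipWord_insertPeak hw (by omega)).isWord_right
  choose X hX using hX
  have h1 : ∀ W : TwoDyck m, slideEnergy ε W.1 = ∑ i : Fin (3 * m + 1), ε (X W i).1 := by
    intro W
    rw [slideEnergy, W.2.1, Finset.sum_range]
    exact Finset.sum_congr rfl fun i _ => by rw [hX]
  have h2 := sum_comp_le_of_code (fun y : TwoDyck m × Fin (3 * m + 1) => X y.1 y.2) (fun y => y.2) ?_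
    (fun X => ε X.1) (fun X => hε _)
  · simp only [h1]
    rw [← Fintype.sum_prod_type' (f := fun W i => ε (X W i).1)]
    refine h2.trans (mul_le_mul_of_nonneg_right ?_ (Finset.sum_nonneg fun _ _ => hε _))
    simp
    linarith
  · rintro ⟨W, i⟩ ⟨W', i'⟩ h h'
    simp only at h h'
    subst h'
    have h3 := congrArg Subtype.val h
    rw [hX, hX, insertPeak, insertPeak, List.append_assoc, List.append_assoc] at h3
    obtain ⟨h4, h5⟩ := List.append_inj h3 (by simp [W.2.1, W'.2.1])
    have h6 := List.append_cancel_left h5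
    have : W = W' := Subtype.ext (by
      rw [← List.take_append_drop (i : ℕ) W.1, h4, h6, List.take_append_drop])
    rw [this]

/-- The pairs of paths related by an oriented adjacent move. -/
abbrev OrientedMove (n : ℕ) : Type := {x : TwoDyck n × TwoDyck n // SwapUD x.1.1 x.2.1}

lemma FlipBound.sum_moves_le {n : ℕ} (hn : 1 ≤ n) {v ε : List DyckStep → ℝ}
    (hb : FlipBound n v ε) :
    ∑ x : OrientedMove n, (v x.1.1.1 - v x.1.2.1) ^ 2 ≤
      2592 * (n : ℝ) ^ 4 * ∑ X : TwoDyck n, ε X.1 := by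
  obtain ⟨m, rfl⟩ : ∃ m, n = m + 1 := ⟨n - 1, by omega⟩
  have key := fun x : OrientedMove (m + 1) => hb.exists_routeWords x.2
  choose P L A Q b Z W hX hX' hR hle using key
  have hlen : ∀ x, (P x).length + (L x).length + (A x).length + 1 < 3 * (m + 1) := by
    intro x
    have := x.1.1.2.1
    rw [hX] at this
    simp at this
    omega
  have heq : ∀ x y, (P x = P y ∧ L x = L y ∧ A x = A y ∧ Q x = Q y) → x = y := by
    rintro x y ⟨h1, h2, h3, h4⟩
    refine Subtype.ext (Prod.ext (Subtype.ext ?_) (Subtype.ext ?_))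
    · rw [hX x, hX y, h1, h2, h3, h4]
    · rw [hX' x, hX' y, h1, h2, h3, h4]
  -- Recording three lengths is wasteful, but the resulting 54 n³ stays below the n⁴ of the slides.
  let k : OrientedMove (m + 1) → Bool × Fin (3 * (m + 1)) × Fin (3 * (m + 1)) × Fin (3 * (m + 1)) :=
    fun x => (b x, ⟨(P x).length, by have := hlen x; omega⟩,
      ⟨(L x).length, by have := hlen x; omega⟩, ⟨(A x).length, by have := hlen x; omega⟩)
  have hk : ∀ {x y}, k x = k y → b x = b y ∧ (P x).length = (P y).length ∧
      (L x).length = (L y).length ∧ (A x).length = (A y).length := by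
    intro x y h
    simpa [k, Prod.ext_iff] using h
  let l : OrientedMove (m + 1) → Bool × Fin (3 * (m + 1)) × Fin (3 * (m + 1)) :=
    fun x => (b x, ⟨(slideCode (P x) (L x) (A x) (b x)).1, by
        have := hlen x; cases b x <;> simp only [slideCode] <;> omega⟩,
      ⟨(slideCode (P x) (L x) (A x) (b x)).2, by
        have := hlen x; cases b x <;> simp only [slideCode] <;> omega⟩)
  have hl : ∀ {x y}, l x = l y → b x = b y ∧
      slideCode (P x) (L x) (A x) (b x) = slideCode (P y) (L y) (A y) (b y) := by
    intro x y h
    simpa [l, Prod.ext_iff] using h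
  have hS : 0 ≤ ∑ X : TwoDyck (m + 1), ε X.1 := Finset.sum_nonneg fun _ _ => hb.nonneg _
  have c1 := sum_comp_le_of_code (fun x : OrientedMove (m + 1) => x.1.1) k
    (fun x y h h' => heq x y (by
      obtain ⟨-, h1, h2, h3⟩ := hk h'
      have h4 := congrArg Subtype.val h
      rw [hX, hX] at h4
      exact blocks_unique (s := [U]) (t := [U]) (u := [U, D]) (by simpa using h4) h1 h2 h3))
    (fun X => ε X.1) (fun _ => hb.nonneg _)
  have c2 := sum_comp_le_of_code (fun x : OrientedMove (m + 1) => x.1.2) k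
    (fun x y h h' => heq x y (by
      obtain ⟨-, h1, h2, h3⟩ := hk h'
      have h4 := congrArg Subtype.val h
      rw [hX', hX'] at h4
      exact blocks_unique (s := [U]) (t := [U]) (u := [D, U]) (by simpa using h4) h1 h2 h3))
    (fun X => ε X.1) (fun _ => hb.nonneg _)
  have c3 := sum_comp_le_of_code Z k
    (fun x y h h' => heq x y (by
      obtain ⟨h0, h1, h2, h3⟩ := hk h'
      have r1 := hR x
      have r2 := hR y
      rw [h, h0] at r1
      exact r1.blocks_unique r2 h1 h2 h3))
    (fun X => ε X.1) (fun _ => hb.nonneg _)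
  have c4 := sum_comp_le_of_code W l
    (fun x y h h' => by
      obtain ⟨h0, h1⟩ := hl h'
      have r1 := hR x
      have r2 := hR y
      rw [h0] at h1
      rw [h, h0] at r1
      have e := r1.slide_unique r2 h1
      refine Subtype.ext (Prod.ext (Subtype.ext ?_) (Subtype.ext ?_))
      · rw [hX x, hX y]
        simpa using e [U, D]
      · rw [hX' x, hX' y]
        simpa using e [D, U])
    (fun W => slideEnergy ε W.1) (fun _ => Finset.sum_nonneg fun _ _ => hb.nonneg _)
  have c5 := sum_slideEnergy_le (m := m) hb.nonneg
  simp only [Fintype.card_prod, Fintype.card_bool, Fintype.card_fin] at c1 c2 c3 c4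
  refine (Finset.sum_le_sum fun x _ => hle x).trans ?_
  simp only [Finset.sum_add_distrib, ← Finset.mul_sum]
  push_cast at *
  set N : ℝ := (m : ℝ) + 1 with hN
  have hN1 : 1 ≤ N := by rw [hN]; linarith [(Nat.cast_nonneg m : (0 : ℝ) ≤ m)]
  set σ := ∑ X : TwoDyck (m + 1), ε X.1
  have c6 : ∑ x, slideEnergy ε (W x).1 ≤ 18 * N ^ 2 * (3 * N * σ) :=
    c4.trans (by
      have := mul_le_mul_of_nonneg_left c5 (by positivity : 0 ≤ 18 * N ^ 2)
      linarith)
  have c7 : 24 * N * ∑ x, slideEnergy ε (W x).1 ≤ 24 * N * (18 * N ^ 2 * (3 * N * σ)) :=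
    mul_le_mul_of_nonneg_left c6 (by positivity)
  -- The separate flips give 8 · 3 · 54 N³ = 1296 N³ and the slides 24 · 18 · 3 N⁴ = 1296 N⁴;
  -- together at most 2592 N⁴.
  have c8 : N ^ 3 * σ ≤ N ^ 4 * σ :=
    mul_le_mul_of_nonneg_right (pow_le_pow_right₀ hN1 (by norm_num)) hS
  linarith

/-! ### Comparison of the Dirichlet forms -/

lemma dirichletFM_eq {n : ℕ} (h : NCST n → ℝ) :
    dirichletFM n h h = 1 / 2 * (1 / (Fintype.card (NCST n) : ℝ)) * ∑ S, flipEnergy h S := by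
  rw [dirichletFM, dirichletForm, mul_assoc, Finset.mul_sum _ _ (1 / (Fintype.card (NCST n) : ℝ))]
  congr 1
  refine Finset.sum_congr rfl fun S _ => ?_
  rw [flipEnergy, Finset.mul_sum]
  refine Finset.sum_congr rfl fun Z _ => ?_
  rw [uniformDist]
  ring

/-- For n ≥ 1 one has 6n - 2 ≥ 4n. Both orientations appear because an adjacent move replaces UD by
DU in one direction. -/
lemma PAM_mul_sq_le {n : ℕ} (hn : 1 ≤ n) (f : TwoDyck n → ℝ) (X Y : TwoDyck n) :
    (f X - f Y) ^ 2 * PAM n X Y ≤ 1 / (4 * n) *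
      ((if SwapUD X.1 Y.1 then (f X - f Y) ^ 2 else 0) +
        if SwapUD Y.1 X.1 then (f Y - f X) ^ 2 else 0) := by
  have hn' : (1 : ℝ) ≤ n := by exact_mod_cast hn
  have h0 : 0 ≤ 1 / (4 * (n : ℝ)) *
      ((if SwapUD X.1 Y.1 then (f X - f Y) ^ 2 else 0) +
        if SwapUD Y.1 X.1 then (f Y - f X) ^ 2 else 0) := by
    refine mul_nonneg (by positivity) (add_nonneg ?_ ?_) <;> split_ifs <;> positivity
  by_cases h1 : X = Y
  · rw [h1] at h0 ⊢
    rw [sub_self] at *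
    linarith
  rw [PAM, if_neg h1]
  by_cases h2 : Y ∈ adjNeighbors X
  · have h3 := (Finset.mem_filter.1 h2).2
    have h4 : (f X - f Y) ^ 2 ≤ (if SwapUD X.1 Y.1 then (f X - f Y) ^ 2 else 0) +
        if SwapUD Y.1 X.1 then (f Y - f X) ^ 2 else 0 := by
      rcases swapUD_or_of_adjSwap h3.2 (fun h => h1 (Subtype.ext h)) with h | h
      · rw [if_pos h]
        have : 0 ≤ if SwapUD Y.1 X.1 then (f Y - f X) ^ 2 else 0 := by split_ifs <;> positivity
        linarith
      · rw [if_pos h, sub_sq_comm (f Y)]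
        have : 0 ≤ if SwapUD X.1 Y.1 then (f X - f Y) ^ 2 else 0 := by split_ifs <;> positivity
        linarith
    rw [if_pos h2, mul_comm]
    refine mul_le_mul ?_ h4 (sq_nonneg _) (by positivity)
    exact one_div_le_one_div_of_le (by positivity) (by linarith)
  · rwa [if_neg h2, mul_zero]

lemma sum_sum_swapUD {n : ℕ} (f : TwoDyck n → ℝ) :
    ∑ X : TwoDyck n, ∑ Y : TwoDyck n, (if SwapUD X.1 Y.1 then (f X - f Y) ^ 2 else 0) =
      ∑ x : OrientedMove n, (f x.1.1 - f x.1.2) ^ 2 := by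
  rw [← Fintype.sum_prod_type' (f := fun X Y : TwoDyck n =>
    if SwapUD X.1 Y.1 then (f X - f Y) ^ 2 else 0), ← Finset.sum_filter]
  exact Finset.sum_subtype _ (by simp) _

lemma dirichletAM_le {n : ℕ} (hn : 1 ≤ n) (f : TwoDyck n → ℝ) :
    dirichletAM n f f ≤ 1 / 2 * (1 / (Fintype.card (TwoDyck n) : ℝ)) *
      (1 / (2 * n) * ∑ x : OrientedMove n, (f x.1.1 - f x.1.2) ^ 2) := by
  have h1 : dirichletAM n f f = 1 / 2 * (1 / (Fintype.card (TwoDyck n) : ℝ)) *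
      ∑ X, ∑ Y, (f X - f Y) ^ 2 * PAM n X Y := by
    rw [dirichletAM, dirichletForm, mul_assoc,
      Finset.mul_sum _ _ (1 / (Fintype.card (TwoDyck n) : ℝ))]
    congr 1
    refine Finset.sum_congr rfl fun S _ => ?_
    rw [Finset.mul_sum]
    refine Finset.sum_congr rfl fun Z _ => ?_
    rw [uniformDist]
    ring
  rw [h1]
  refine mul_le_mul_of_nonneg_left ?_ (by positivity)
  refine (Finset.sum_le_sum fun X _ => Finset.sum_le_sum fun Y _ =>
    PAM_mul_sq_le hn f X Y).trans (le_of_eq ?_)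
  simp only [← Finset.mul_sum, Finset.sum_add_distrib]
  rw [Finset.sum_comm (f := fun X Y : TwoDyck n => if SwapUD Y.1 X.1 then (f Y - f X) ^ 2 else 0),
    sum_sum_swapUD]
  have : (n : ℝ) ≠ 0 := by positivity
  field_simp
  ring

/-- The `2 * n` in the energies of `flipBound_extend` cancels the `1 / (2 * n)` of `dirichletAM_le`,
leaving n⁴. -/
lemma dirichletAM_le_dirichletFM {n : ℕ} (hn : 1 ≤ n) (f : TwoDyck n → ℝ) :
    dirichletAM n f f ≤ 2592 * (n : ℝ) ^ 4 * dirichletFM n (fun T => f ((treeEquiv n).symm T))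
      (fun T => f ((treeEquiv n).symm T)) := by
  have hn' : (0 : ℝ) < n := by exact_mod_cast hn
  have h1 := (flipBound_extend f).sum_moves_le hn
  simp only [extend_coe] at h1
  rw [(treeEquiv n).sum_comp
    (fun T => 2 * (n : ℝ) * flipEnergy (fun T => f ((treeEquiv n).symm T)) T), ← Finset.mul_sum] at h1
  refine (dirichletAM_le hn f).trans ?_
  rw [dirichletFM_eq, ← Fintype.card_congr (treeEquiv n)]
  have h2 := mul_le_mul_of_nonneg_left h1 (by positivity : 0 ≤ 1 / (2 * (n : ℝ)))
  have h3 := mul_le_mul_of_nonneg_left h2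
    (by positivity : 0 ≤ 1 / 2 * (1 / (Fintype.card (TwoDyck n) : ℝ)))
  refine h3.trans (le_of_eq ?_)
  field_simp

end FlipChain

end

theorem mainTheorem3 :
    ∃ c : ℝ, 0 < c ∧ ∀ n : ℕ, 1 ≤ n →
      ∃ Φ : FlipChain.TwoDyck n ≃ FlipChain.NCST n,
        (∀ (X : FlipChain.TwoDyck n) (T : FlipChain.NCST n),
          Φ X = T ↔ FlipChain.Corresponds X.1 0 n T.1) ∧
        ∀ f : FlipChain.TwoDyck n → ℝ,
          FlipChain.dirichletFM n (fun T => f (Φ.symm T)) (fun T => f (Φ.symm T)) ≥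
            c * ((n : ℝ) ^ 4)⁻¹ * FlipChain.dirichletAM n f f := by
  refine ⟨1 / 2592, by norm_num, fun n hn =>
    ⟨FlipChain.treeEquiv n, FlipChain.treeEquiv_eq_iff, fun f => ?_⟩⟩
  have hn' : (0 : ℝ) < n := by exact_mod_cast hn
  have h1 := mul_le_mul_of_nonneg_left (FlipChain.dirichletAM_le_dirichletFM hn f)
    (by positivity : 0 ≤ 1 / 2592 * ((n : ℝ) ^ 4)⁻¹)
  refine h1.trans (le_of_eq ?_)
  field_simp
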